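/- Let $q>2$ be a prime power. Let $p_1,\dots,p_{q^2+q+1}$ be an ordering of the points of $\mathbb{P}^2(\mathbb{F}_q)$, let $p_i'\in\mathbb{F}_q^3\setminus\{0\}$ be a representative of $p_i$, and let $\operatorname{ev}(f)=(f(p_1'),\dots,f(p_{q^2+q+1}'))$. Let $C_{2,3}\subseteq\mathbb{F}_q^{q^2+q+1}$ be the image under $\operatorname{ev}$ of the space $\mathbb{F}_q[x,y,z]_3$ of homogeneous cubic polynomials. For vectors $c,c_1,c_2\in\mathbb{F}_q^{q^2+q+1}$ let $\operatorname{wt}(c)$ be the number of nonzero coordinates of $c$, and let $\operatorname{wt}(c_1,c_2)$ be the number of coordinates in which $c_1$ and $c_2$ are not both $0$. Put $$W_{C_{2,3}}(X,Y)=\sum_{c\in C_{2,3}}X^{q^2+q+1-\operatorname{wt}(c)}Y^{\operatorname{wt}(c)},\qquad W^{[2]}_{C_{2,3}}(X,Y)=\sum_{c_1,c_2\in C_{2,3}}X^{q^2+q+1-\operatorname{wt}(c_1,c_2)}Y^{\operatorname{wt}(c_1,c_2)}.$$ Let $W^{[2],\mathrm{com}}_{C_{2,3}}(X,Y)$ be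 the contribution to $W^{[2]}_{C_{2,3}}(X,Y)$ from pairs of nonzero polynomials that define distinct cubic curves sharing a common component, that is, the sum of $X^{q^2+q+1-w}Y^{w}$ with $w=\operatorname{wt}(\operatorname{ev}(f),\operatorname{ev}(g))$ over all ordered pairs $(f,g)$ of nonzero elements of $\mathbb{F}_q[x,y,z]_3$ that are not scalar multiples of each other and have a common irreducible factor over $\overline{\mathbb{F}_q}$. Then $$W^{[2],\mathrm{com}}_{C_{2,3}}(X,Y)=a_1XY^{q^2+q}+a_2X^2Y^{q^2+q-1}+a_{2q+1}X^{2q+1}Y^{q^2-q}+a_{2q+2}X^{2q+2}Y^{q^2-q-1}+\sum_{i=q+1}^{q+5}a_iX^iY^{q^2+q+1-i},$$ where the nine symbols $a_1,a_2,a_{2q+1},a_{2q+2},a_{q+1},\dots,a_{q+5}$ denote separate coefficients (also when two of the exponents of $X$ coincide), given by $$\begin{aligned} a_1&=\tfrac12(q-1)^2(q^2+q+1)(q^2-q)(q+1)q,\\ a_2&=\tfrac12(q-1)^2(q^2+q+1)(q^2-q)(q^2+q)(q+1)q,\\ a_{2q+1}&=\tfrac12(q^2+q+1)(2q+1)(q-1)^2q^2(q+1)^2,\\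 a_{2q+2}&=\tfrac12(q^2+q+1)(q-1)^2(q^2+q)^2(q^2-q),\\ a_{q+1}&=\tfrac1{24}(9q^8+8q^7+21q^6-19q^5+66q^4+59q^3-48q^2+24)(q^2+q+1)(q+1)(q-1)^2q,\\ a_{q+2}&=\tfrac16(2q^5+2q^4-7q^3+42q^2-33q+6)(q^2+q+1)(q+1)^2(q-1)^2q^3,\\ a_{q+3}&=\tfrac14(q^3-2q^2+14q-11)(q^2+q+1)(q+1)^2(q-1)^3q^4,\\ a_{q+4}&=\tfrac16(q^2+q+1)(4q-5)(q+1)^2(q-1)^4q^4,\\ a_{q+5}&=\tfrac1{24}(q-1)^4q^4(q+1)^2(q^2+q+1)(q^2-3q+3). \end{aligned}$$ Moreover, $$W^{[2]}_{C_{2,3}}(X,Y)=(q+1)W_{C_{2,3}}(X,Y)-qX^{q^2+q+1}+W^{[2],\mathrm{com}}_{C_{2,3}}(X,Y)+\sum_{j=0}^{9}c_jX^jY^{q^2+q+1-j}$$ for some nonnegative integers $c_0,c_1,\dots,c_9$. -/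

import Mathlib

open MvPolynomial
open scoped LinearAlgebra.Projectivization

namespace PlaneCubics

/-- The weight `wt(c₁, c₂)`: the number of coordinates in which `c₁` and `c₂` are not both zero. -/
noncomputable def pairWeight {F : Type*} [Field F] {N : ℕ} (c₁ c₂ : Fin N → F) : ℕ := by
  classical
  exact (Finset.univ.filter fun i => c₁ i ≠ 0 ∨ c₂ i ≠ 0).card

/-- The Hamming weight: the number of nonzero coordinates. -/
noncomputable def weight {F : Type*} [Field F] {N : ℕ} (c : Fin N → F) : ℕ := by
  classical
  exact (Finset.univ.filter fun i => c i ≠ 0).card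

/-- The monomial `X ^ a * Y ^ b` in `ℚ[X, Y]`. -/
noncomputable def mono (a b : ℕ) : MvPolynomial (Fin 2) ℚ := X 0 ^ a * X 1 ^ b

open Classical in
/-- The Hamming weight enumerator `W_C(X, Y)` of a code `C` of length `N`. -/
noncomputable def weightEnumerator {F : Type*} [Field F] [Fintype F] {N : ℕ}
    (C : Set (Fin N → F)) : MvPolynomial (Fin 2) ℚ :=
  ∑ c : Fin N → F with c ∈ C, mono (N - weight c) (weight c)

open Classical in
/-- The second weight enumerator of a code `C` of length `N`: the sum over all ordered pairs
`(c₁, c₂)` of codewords of `X ^ (N - wt(c₁, c₂)) * Y ^ wt(c₁, c₂)`. -/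
noncomputable def secondWeightEnumerator {F : Type*} [Field F] [Fintype F] {N : ℕ}
    (C : Set (Fin N → F)) : MvPolynomial (Fin 2) ℚ :=
  ∑ c₁ : Fin N → F with c₁ ∈ C, ∑ c₂ : Fin N → F with c₂ ∈ C,
    mono (N - pairWeight c₁ c₂) (pairWeight c₁ c₂)

/-- The map `f ↦ (f(v 0), …, f(v (N - 1)))` evaluating a ternary polynomial at a list of vectors. -/
noncomputable def ev {F : Type*} [Field F] {N : ℕ} (v : Fin N → Fin 3 → F) :
    MvPolynomial (Fin 3) F →ₗ[F] (Fin N → F) :=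
  LinearMap.pi fun i => (MvPolynomial.aeval (v i) : MvPolynomial (Fin 3) F →ₐ[F] F).toLinearMap

/-- The projective Reed-Muller code `C_{2,d}`, the image of the ternary forms of degree `d` under
evaluation at the vectors `v i`, which are meant to be representatives of all points of the
projective plane. -/
noncomputable def reedMuller {F : Type*} [Field F] {N : ℕ} (v : Fin N → Fin 3 → F) (d : ℕ) :
    Submodule F (Fin N → F) :=
  (homogeneousSubmodule (Fin 3) F d).map (ev v)

/-- Two forms define the same plane curve when one is a nonzero scalar multiple of the other. -/
def SameCurve {F : Type*} [Field F] (f g : MvPolynomial (Fin 3) F) : Prop :=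
  ∃ a : F, a ≠ 0 ∧ g = a • f

/-- The plane curves `f = 0` and `g = 0` share a common component over the algebraic closure:
`f` and `g` have a common irreducible factor there. -/
def ShareComponent {F : Type*} [Field F] (f g : MvPolynomial (Fin 3) F) : Prop :=
  ∃ h : MvPolynomial (Fin 3) (AlgebraicClosure F), Irreducible h ∧
    h ∣ MvPolynomial.map (algebraMap F (AlgebraicClosure F)) f ∧
    h ∣ MvPolynomial.map (algebraMap F (AlgebraicClosure F)) g

/-- There are finitely many forms of given degree over a finite field. -/
instance finite_forms {F : Type*} [Field F] [Finite F] (d : ℕ) :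
    Finite (homogeneousSubmodule (Fin 3) F d) := by
  have : Module.Finite F (homogeneousSubmodule (Fin 3) F d) :=
    Module.Finite.iff_fg.mpr (homogeneousSubmodule_fg (Fin 3) F d)
  exact Module.finite_of_finite F

noncomputable instance fintypeForms {F : Type*} [Field F] [Finite F] (d : ℕ) :
    Fintype (homogeneousSubmodule (Fin 3) F d) :=
  Fintype.ofFinite _

open Classical in
/-- The contribution to the second weight enumerator of the code from plane cubics of the ordered
pairs `(f, g)` of nonzero cubic forms that define distinct curves sharing a common component. -/
noncomputable def comEnumerator {F : Type*} [Field F] [Fintype F] {N : ℕ}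
    (v : Fin N → Fin 3 → F) : MvPolynomial (Fin 2) ℚ :=
  ∑ p : homogeneousSubmodule (Fin 3) F 3 × homogeneousSubmodule (Fin 3) F 3
    with p.1 ≠ 0 ∧ p.2 ≠ 0 ∧
      ¬ SameCurve (p.1 : MvPolynomial (Fin 3) F) (p.2 : MvPolynomial (Fin 3) F) ∧
      ShareComponent (p.1 : MvPolynomial (Fin 3) F) (p.2 : MvPolynomial (Fin 3) F),
    mono (N - pairWeight (ev v p.1) (ev v p.2)) (pairWeight (ev v p.1) (ev v p.2))

end PlaneCubics

/-! Every pair (f, g) ≠ (0, 0) of cubic forms is (h a, h b) with a, b coprime, uniquely up to a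
scalar moved between h and (a, b). Its common zeros are the zeros of h together with the common
zeros of (a, b), so the second weight enumerator splits according to the degree of h
(`sum_nonzeroPairs`). Degree 0 gives the coprime pairs, which have at most 9 common zeros
(`card_commonZeros_le`) and produce the c_j. Degree 3 gives the proportional pairs, which together
with (0, 0) produce (q + 1) W - q X^(q^2+q+1). Degrees 1 and 2 are the pairs of distinct curves with
a common component; a common factor over the algebraic closure already forces one over F.

If h is a conic, it has 1, q + 1 or 2q + 1 points (`card_zeros_conic`), and three moments determine
how often each value occurs. The residual pair of distinct lines meets in one point, equidistributed
over the plane (`sum_relPairs_one_points`), which is either new or already on h.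

If h is a line l, the question is how many common zeros a coprime pair of conics has off l. There
are at most 4, so the binomial moments of orders 0 to 4 determine the distribution
(`sum_relPairs_two_inter_compl`). The k-th moment counts pairs of conics through k points off l,
after removing the proportional pairs and those with a common line. Up to three points impose
independent conditions on conics; four points do so exactly when they are not collinear, so the
fourth moment needs a count of collinear quadruples (`sum_powersetCard_four`).

All these sums are computed for an arbitrary weight φ : ℕ → ℚ of the number of common zeros. The
polynomial identities follow by letting φ(n) be a coefficient of X^n Y^(q^2+q+1-n). -/

namespace PlaneCubics

/-! ### Homogeneous polynomials over a field -/

section Homogeneous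

variable {σ K : Type*} [Field K]

/-- The substitution `X i ↦ X i * T`, which separates the homogeneous components. -/
noncomputable def scaleHom : MvPolynomial σ K →ₐ[K] Polynomial (MvPolynomial σ K) :=
  aeval fun i => Polynomial.C (X i) * Polynomial.X

lemma scaleHom_monomial (m : σ →₀ ℕ) (c : K) :
    scaleHom (monomial m c) = Polynomial.C (monomial m c) * Polynomial.X ^ m.degree := by
  classical
  rw [scaleHom, aeval_monomial, monomial_eq]
  simp only [Finsupp.prod, mul_pow, Finset.prod_mul_distrib, map_mul, map_prod, map_pow]
  rw [Finset.prod_pow_eq_pow_sum, Finsupp.degree, mul_assoc]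
  rfl

lemma scaleHom_coeff (p : MvPolynomial σ K) (k : ℕ) :
    (scaleHom p).coeff k = homogeneousComponent k p := by
  classical
  induction p using MvPolynomial.induction_on' with
  | monomial m c =>
    rw [scaleHom_monomial, Polynomial.coeff_C_mul_X_pow]
    split_ifs with h
    · exact (homogeneousComponent_eq_self (isHomogeneous_monomial c h.symm)).symm
    · rw [homogeneousComponent_of_mem (isHomogeneous_monomial c rfl), if_neg]
      exact fun h' => h h'
  | add p q hp hq => rw [map_add, Polynomial.coeff_add, hp, hq, map_add]

lemma scaleHom_injective : Function.Injective (scaleHom (σ := σ) (K := K)) := by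
  intro p q h
  ext m
  have := congrArg (fun r => coeff m (Polynomial.coeff r m.degree)) h
  simpa [scaleHom_coeff, coeff_homogeneousComponent] using this

/-- The coefficient of T^k in `scaleHom p` is the component of degree k of p, so a single power of T
means a single component. -/
lemma isHomogeneous_of_scaleHom {p : MvPolynomial σ K}
    (h : (scaleHom p).natDegree = (scaleHom p).natTrailingDegree) :
    p.IsHomogeneous (scaleHom p).natDegree := by
  intro m hm
  by_contra hne
  refine hm ?_
  have h1 : (scaleHom p).coeff m.degree = 0 := by
    rcases lt_or_gt_of_ne (show m.degree ≠ (scaleHom p).natDegree by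
      rwa [Finsupp.degree_eq_weight_one]) with h2 | h2
    · exact Polynomial.coeff_eq_zero_of_lt_natTrailingDegree (h ▸ h2)
    · exact Polynomial.coeff_eq_zero_of_natDegree_lt h2
  have := congrArg (coeff m) h1
  simpa [scaleHom_coeff, coeff_homogeneousComponent] using this

/-- A factor of a nonzero homogeneous polynomial is homogeneous. -/
lemma isHomogeneous_of_mul {a b : MvPolynomial σ K} {n : ℕ} (h : (a * b).IsHomogeneous n)
    (hab : a * b ≠ 0) :
    ∃ k l, k + l = n ∧ a.IsHomogeneous k ∧ b.IsHomogeneous l := by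
  have hs : scaleHom (a * b) = Polynomial.C (a * b) * Polynomial.X ^ n := by
    ext1 k
    rw [scaleHom_coeff, Polynomial.coeff_C_mul_X_pow]
    split_ifs with hk
    · rw [hk, homogeneousComponent_eq_self h]
    · rw [homogeneousComponent_of_mem h, if_neg hk]
  have ha := left_ne_zero_of_mul hab
  have hb := right_ne_zero_of_mul hab
  have ha' : scaleHom a ≠ 0 := (map_ne_zero_iff _ scaleHom_injective).2 ha
  have hb' : scaleHom b ≠ 0 := (map_ne_zero_iff _ scaleHom_injective).2 hb
  -- Degree and trailing degree in T are both additive, and both equal n for the product. Since the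
  -- trailing degree never exceeds the degree, they agree for each factor.
  have h1 : (scaleHom a).natDegree + (scaleHom b).natDegree = n := by
    rw [← Polynomial.natDegree_mul ha' hb', ← map_mul, hs, Polynomial.natDegree_C_mul_X_pow _ _ hab]
  have h2 : (scaleHom a).natTrailingDegree + (scaleHom b).natTrailingDegree = n := by
    rw [← Polynomial.natTrailingDegree_mul ha' hb', ← map_mul, hs, Polynomial.C_mul_X_pow_eq_monomial,
      Polynomial.natTrailingDegree_monomial hab]
  have h3 := (scaleHom a).natTrailingDegree_le_natDegree
  have h4 := (scaleHom b).natTrailingDegree_le_natDegree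
  exact ⟨_, _, h1, isHomogeneous_of_scaleHom (by omega), isHomogeneous_of_scaleHom (by omega)⟩

lemma isUnit_of_isHomogeneous_zero {f : MvPolynomial σ K} (h : f.IsHomogeneous 0) (h0 : f ≠ 0) :
    IsUnit f := by
  rw [isUnit_iff_eq_C_of_isReduced]
  rw [← totalDegree_zero_iff_isHomogeneous, totalDegree_eq_zero_iff_eq_C] at h
  refine ⟨_, ?_, h⟩
  rw [isUnit_iff_ne_zero]
  rintro h1
  rw [h1] at h
  simp at h
  exact h0 h

lemma isHomogeneous_zero_of_isUnit {f : MvPolynomial σ K} (h : IsUnit f) : f.IsHomogeneous 0 := by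
  obtain ⟨r, -, rfl⟩ := isUnit_iff_eq_C_of_isReduced.1 h
  exact isHomogeneous_C _ _

lemma exists_gcd (f g : MvPolynomial σ K) (h : f ≠ 0 ∨ g ≠ 0) :
    ∃ D a b, f = D * a ∧ g = D * b ∧ D ≠ 0 ∧ IsRelPrime a b := by
  let _ := UniqueFactorizationMonoid.toGCDMonoid (MvPolynomial σ K)
  have h0 : gcd f g ≠ 0 := by
    rw [Ne, gcd_eq_zero_iff]; tauto
  obtain ⟨a, ha⟩ := gcd_dvd_left f g
  obtain ⟨b, hb⟩ := gcd_dvd_right f g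
  exact ⟨_, a, b, ha, hb, h0, gcd_isUnit_iff_isRelPrime.1
    (isUnit_gcd_of_eq_mul_gcd (x := f) (y := g) ha hb h0)⟩

/-- `D` and `E` are both greatest common divisors of one and the same pair. -/
lemma associated_of_mul_eq_mul {D E a b c d : MvPolynomial σ K} (h1 : D * a = E * c)
    (h2 : D * b = E * d) (hab : IsRelPrime a b) (hcd : IsRelPrime c d) : Associated D E := by
  let _ := UniqueFactorizationMonoid.toGCDMonoid (MvPolynomial σ K)
  have key : ∀ {D a b : MvPolynomial σ K}, IsRelPrime a b → Associated (gcd (D * a) (D * b)) D := by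
    intro D a b h
    refine (gcd_mul_left' D a b).trans ?_
    exact associated_mul_unit_left _ _ (gcd_isUnit_iff_isRelPrime.2 h)
  have := key (D := D) hab
  rw [h1, h2] at this
  exact this.symm.trans (key hcd)

end Homogeneous

/-! ### Common components over the algebraic closure -/

/-- An F-linear functional on K, applied coefficientwise, brings a polynomial down to F; by
`coeff_mul_map_of_coeff_map` this operation commutes with multiplication by polynomials over F. -/
lemma exists_coeff_map {σ F K : Type*} [Field F] [Field K] [Algebra F K] (φ : K →ₗ[F] F)
    (p : MvPolynomial σ K) : ∃ p' : MvPolynomial σ F, ∀ m, coeff m p' = φ (coeff m p) := by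
  classical
  refine ⟨∑ m ∈ p.support, monomial m (φ (coeff m p)), fun m => ?_⟩
  rw [coeff_sum]
  simp only [coeff_monomial]
  rw [Finset.sum_ite_eq']
  split_ifs with h
  · rfl
  · rw [notMem_support_iff.1 h, map_zero]

lemma coeff_mul_map_of_coeff_map {σ F K : Type*} [Field F] [Field K] [Algebra F K] (φ : K →ₗ[F] F)
    {p : MvPolynomial σ K} {p' : MvPolynomial σ F} (h : ∀ m, coeff m p' = φ (coeff m p))
    (f : MvPolynomial σ F) (m : σ →₀ ℕ) :
    coeff m (p' * f) = φ (coeff m (p * map (algebraMap F K) f)) := by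
  classical
  rw [coeff_mul, coeff_mul, map_sum]
  refine Finset.sum_congr rfl fun x _ => ?_
  rw [coeff_map, mul_comm (coeff x.1 p), ← Algebra.smul_def, map_smul, h, smul_eq_mul, mul_comm]

lemma totalDegree_map_of_injective {σ R S : Type*} [CommSemiring R] [CommSemiring S]
    (p : MvPolynomial σ R) {i : R →+* S} (hi : Function.Injective i) :
    (MvPolynomial.map i p).totalDegree = p.totalDegree := by
  rw [totalDegree, totalDegree, support_map_of_injective _ hi]

/-- Writing f = h a and g = h b over the closure gives a g = b f. A functional that does not kill
some coefficient of a turns this into a' g = b' f over F with a' ≠ 0. If f and g were coprime, f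
would divide a', although deg a' ≤ deg a < deg f. -/
lemma not_isRelPrime_of_shareComponent {F : Type*} [Field F] {f g : MvPolynomial (Fin 3) F}
    (hf : f ≠ 0) (hg : g ≠ 0) (h : ShareComponent f g) : ¬ IsRelPrime f g := by
  obtain ⟨h, hirr, ⟨a, ha⟩, ⟨b, hb⟩⟩ := h
  intro hrel
  set i := algebraMap F (AlgebraicClosure F) with hi
  have hinj : Function.Injective (MvPolynomial.map (σ := Fin 3) i) :=
    map_injective _ i.injective
  have hf' : MvPolynomial.map i f ≠ 0 := by
    rw [Ne, map_eq_zero_iff _ hinj]; exact hf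
  have hg' : MvPolynomial.map i g ≠ 0 := by
    rw [Ne, map_eq_zero_iff _ hinj]; exact hg
  have hh0 : h ≠ 0 := hirr.ne_zero
  have ha0 : a ≠ 0 := by rintro rfl; simp at ha; exact hf' (by simpa using ha)
  have hb0 : b ≠ 0 := by rintro rfl; simp at hb; exact hg' (by simpa using hb)
  obtain ⟨m, hm⟩ := ne_zero_iff.1 ha0
  obtain ⟨φ, hφ⟩ := Module.Projective.exists_dual_ne_zero F hm
  obtain ⟨a', ha'⟩ := exists_coeff_map φ a
  obtain ⟨b', hb'⟩ := exists_coeff_map φ b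
  have heq : a' * g = b' * f := by
    ext m
    rw [coeff_mul_map_of_coeff_map φ ha', coeff_mul_map_of_coeff_map φ hb', ← hi, ha, hb]
    ring_nf
  have hdvd : f ∣ a' := hrel.dvd_of_dvd_mul_right ⟨b', by rw [heq, mul_comm]⟩
  have ha'0 : a' ≠ 0 := ne_zero_iff.2 ⟨m, by rwa [ha']⟩
  obtain ⟨c, hc⟩ := hdvd
  have hc0 : c ≠ 0 := by rintro rfl; exact ha'0 (by simpa using hc)
  have h1 : a'.totalDegree ≤ a.totalDegree := by
    refine Finset.sup_mono fun k hk => ?_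
    rw [mem_support_iff] at hk ⊢
    intro h0
    exact hk (by rw [ha', h0, map_zero])
  have h2 : a'.totalDegree = f.totalDegree + c.totalDegree := by
    rw [hc, totalDegree_mul_of_isDomain hf hc0]
  have h3 : f.totalDegree = h.totalDegree + a.totalDegree := by
    rw [← totalDegree_mul_of_isDomain hh0 ha0, ← ha, totalDegree_map_of_injective _ i.injective]
  have h4 : h.totalDegree ≠ 0 := by
    intro h4
    refine hirr.not_isUnit (isUnit_of_isHomogeneous_zero ?_ hh0)
    exact (totalDegree_zero_iff_isHomogeneous _).1 h4
  omega

lemma shareComponent_of_not_isRelPrime {F : Type*} [Field F] {f g : MvPolynomial (Fin 3) F}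
    (hf : f ≠ 0)  (h : ¬ IsRelPrime f g) : ShareComponent f g := by
  simp only [IsRelPrime, not_forall] at h
  obtain ⟨d, hdf, hdg, hd⟩ := h
  set i := algebraMap F (AlgebraicClosure F) with hi
  have hinj : Function.Injective (MvPolynomial.map (σ := Fin 3) i) :=
    map_injective _ i.injective
  have hd0 : d ≠ 0 := by rintro rfl; exact hf (zero_dvd_iff.1 hdf)
  have hu : ¬ IsUnit (MvPolynomial.map i d) := by
    intro hu
    have h1 := (totalDegree_zero_iff_isHomogeneous _).2 (isHomogeneous_zero_of_isUnit hu)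
    rw [totalDegree_map_of_injective _ i.injective] at h1
    exact hd (isUnit_of_isHomogeneous_zero ((totalDegree_zero_iff_isHomogeneous _).1 h1) hd0)
  obtain ⟨h, hirr, hdvd⟩ := WfDvdMonoid.exists_irreducible_factor hu
    (by rw [Ne, map_eq_zero_iff _ hinj]; exact hd0)
  exact ⟨h, hirr, hdvd.trans (map_dvd _ hdf), hdvd.trans (map_dvd _ hdg)⟩

/-! ### Finite sets of forms -/

section Forms

variable {F : Type*} [Field F]

/-- The finite set of ternary forms of degree `d`, including `0`. -/
noncomputable def forms (F : Type*) [Field F] [Fintype F] (d : ℕ) :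
    Finset (MvPolynomial (Fin 3) F) :=
  Set.Finite.toFinset (s := (homogeneousSubmodule (Fin 3) F d : Set (MvPolynomial (Fin 3) F)))
    (Set.finite_coe_iff.1 (finite_forms d))

@[simp]
lemma mem_forms [Fintype F] {d : ℕ} {f : MvPolynomial (Fin 3) F} : f ∈ forms F d ↔ f.IsHomogeneous d := by
  simp [forms]

lemma card_range_mul_card_ker {V W : Type*} [AddCommGroup V] [AddCommGroup W] [Module F V]
    [Module F W] (φ : V →ₗ[F] W) :
    Nat.card (LinearMap.range φ) * Nat.card (LinearMap.ker φ) = Nat.card V := by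
  rw [Submodule.card_eq_card_quotient_mul_card (LinearMap.ker φ),
    Nat.card_congr φ.quotKerEquivRange.toEquiv, mul_comm]

lemma eval_smul_of_isHomogeneous {d : ℕ} {f : MvPolynomial (Fin 3) F} (hf : f.IsHomogeneous d)
    (a : F) (w : Fin 3 → F) : eval (a • w) f = a ^ d * eval w f := by
  rw [eval_eq, eval_eq, Finset.mul_sum]
  refine Finset.sum_congr rfl fun m hm => ?_
  have h := hf.degree_eq_sum_deg_support hm
  simp only [Pi.smul_apply, smul_eq_mul, mul_pow, Finset.prod_mul_distrib]
  rw [Finset.prod_pow_eq_pow_sum, ← h]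
  ring

variable [Fintype F]

lemma natCard_forms (d : ℕ) : Nat.card (homogeneousSubmodule (Fin 3) F d) = (forms F d).card := by
  rw [← Set.ncard_coe_finset, forms, Set.Finite.coe_toFinset]
  rfl

lemma card_forms (d : ℕ) : (forms F d).card = Fintype.card F ^ (d + 2).choose 2 := by
  classical
  let A := (Finset.univ : Finset (Fin 3)).finsuppAntidiag d
  have hA : ∀ m, m ∈ A ↔ m.degree = d := fun m => by
    simp [A, Finset.mem_finsuppAntidiag, Finsupp.degree_eq_sum]
  let φ : homogeneousSubmodule (Fin 3) F d → A → F := fun f m => coeff m f.1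
  have hφ : Function.Bijective φ := by
    constructor
    · intro f g h
      ext m
      by_cases hm : m.degree = d
      · exact congrFun h ⟨m, (hA m).2 hm⟩
      · rw [IsHomogeneous.coeff_eq_zero f.2 hm, IsHomogeneous.coeff_eq_zero g.2 hm]
    · intro c
      refine ⟨⟨∑ m : A, monomial m.1 (c m), IsHomogeneous.sum _ _ _ fun m _ =>
        isHomogeneous_monomial _ ((hA m).1 m.2)⟩, ?_⟩
      ext m
      simp only [φ, coeff_sum, coeff_monomial]
      rw [Finset.sum_eq_single m]
      · simp
      · intro k _ hk
        rw [if_neg (fun h => hk (Subtype.ext h))]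
      · simp
  rw [← natCard_forms, Nat.card_congr (Equiv.ofBijective φ hφ), Nat.card_eq_fintype_card,
    Fintype.card_fun, Fintype.card_coe, Finset.card_finsuppAntidiag_nat_eq_choose]
  congr 1
  rw [Finset.card_univ, Fintype.card_fin, show 3 + d - 1 = d + 2 by omega,
    ← Nat.choose_symm (show 2 ≤ d + 2 by omega)]
  rfl

variable {ι : Type*}

open Classical in
/-- The forms of degree `d` that vanish at the points indexed by `S`. -/
noncomputable def formsOn (v : ι → Fin 3 → F) (d : ℕ) (S : Finset ι) :
    Finset (MvPolynomial (Fin 3) F) :=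
  (forms F d).filter fun f => ∀ i ∈ S, eval (v i) f = 0

@[simp]
lemma mem_formsOn {v : ι → Fin 3 → F} {d : ℕ} {S : Finset ι} {f : MvPolynomial (Fin 3) F} :
    f ∈ formsOn v d S ↔ f.IsHomogeneous d ∧ ∀ i ∈ S, eval (v i) f = 0 := by
  simp [formsOn]

/-- The hypothesis says that the points of S impose independent conditions: evaluation maps the
forms of degree d onto F^S, and its kernel has index q^|S|. -/
lemma card_formsOn_mul (v : ι → Fin 3 → F) (d : ℕ) (S : Finset ι)
    (h : ∀ i ∈ S, ∃ f : MvPolynomial (Fin 3) F, f.IsHomogeneous d ∧ eval (v i) f ≠ 0 ∧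
      ∀ j ∈ S, j ≠ i → eval (v j) f = 0) :
    (formsOn v d S).card * Fintype.card F ^ S.card = Fintype.card F ^ (d + 2).choose 2 := by
  classical
  let φ : homogeneousSubmodule (Fin 3) F d →ₗ[F] (S → F) :=
    LinearMap.pi fun i => (MvPolynomial.aeval (v i) :
      MvPolynomial (Fin 3) F →ₐ[F] F).toLinearMap.comp (Submodule.subtype _)
  have hφ : ∀ f i, φ f i = eval (v i) f.1 := fun f i => by
    simp [φ]
  have hsurj : LinearMap.range φ = ⊤ := by
    rw [LinearMap.range_eq_top]
    intro c
    choose f hf1 hf2 hf3 using h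
    refine ⟨∑ i : S, (c i / eval (v i) (f i i.2)) • ⟨f i i.2, hf1 i i.2⟩, ?_⟩
    ext i
    rw [map_sum, Finset.sum_apply, Finset.sum_eq_single i]
    · rw [map_smul, Pi.smul_apply, hφ, smul_eq_mul, div_mul_cancel₀ _ (hf2 i i.2)]
    · intro j _ hji
      rw [map_smul, Pi.smul_apply, hφ, hf3 j j.2 i i.2 (fun h => hji (Subtype.ext h.symm)), smul_zero]
    · simp
  have h1 := card_range_mul_card_ker φ
  rw [hsurj] at h1
  have h3 : Nat.card (LinearMap.ker φ) = (formsOn v d S).card := by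
    rw [← Nat.card_eq_finsetCard]
    refine Nat.card_congr ⟨fun f => ⟨f.1.1, mem_formsOn.2 ⟨f.1.2, fun i hi => ?_⟩⟩,
      fun f => ⟨⟨f.1, (mem_formsOn.1 f.2).1⟩, ?_⟩, fun f => rfl, fun f => rfl⟩
    · rw [← hφ f.1 ⟨i, hi⟩, LinearMap.mem_ker.1 f.2]
      rfl
    · rw [LinearMap.mem_ker]
      ext i
      rw [hφ]
      exact (mem_formsOn.1 f.2).2 i i.2
  have h4 : Nat.card (⊤ : Submodule F (S → F)) = Fintype.card F ^ S.card := by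
    rw [Nat.card_congr Submodule.topEquiv.toEquiv, Nat.card_eq_fintype_card]
    simp
  rw [natCard_forms, h3, h4, card_forms] at h1
  rw [← h1, mul_comm]

end Forms

/-! ### Systems of representatives of the points of the plane -/

section Points

variable {F : Type*} [Field F] {ι : Type*}

/-- The vectors `v i` represent every point of the projective plane exactly once. -/
structure IsPointSystem (v : ι → Fin 3 → F) : Prop where
  ne_zero : ∀ i, v i ≠ 0
  eq_of_smul : ∀ i j (a : F), v i = a • v j → i = j
  exists_smul : ∀ w, w ≠ 0 → ∃ i, ∃ a : F, w = a • v i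

lemma IsPointSystem.exists_separating {v : ι → Fin 3 → F} (hv : IsPointSystem v) {i j : ι}
    (hij : i ≠ j) : ∃ f : MvPolynomial (Fin 3) F, f.IsHomogeneous 1 ∧ eval (v i) f ≠ 0 ∧
      eval (v j) f = 0 := by
  -- The forms v_j(l) X_k - v_j(k) X_l all vanish at v_j. If all vanish at v_i too, the 2 × 2 minors
  -- of the two vectors are zero and the vectors are proportional.
  by_contra! hcon
  have key : ∀ k l, v i k * v j l = v i l * v j k := by
    intro k l
    by_contra hne
    refine hcon (C (v j l) * X k - C (v j k) * X l)
      ((isHomogeneous_C_mul_X _ _).sub (isHomogeneous_C_mul_X _ _)) ?_ ?_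
    · simp only [map_sub, map_mul, eval_C, eval_X]
      intro h
      apply hne
      linear_combination h
    · simp only [map_sub, map_mul, eval_C, eval_X]
      ring
  obtain ⟨k, hk⟩ := Function.ne_iff.1 (hv.ne_zero j)
  refine hij (hv.eq_of_smul i j (v i k / v j k) ?_)
  ext l
  rw [Pi.smul_apply, smul_eq_mul, div_mul_eq_mul_div, eq_div_iff hk, key]

lemma IsPointSystem.exists_eval_ne_zero {v : ι → Fin 3 → F} (hv : IsPointSystem v) (i : ι) :
    ∃ f : MvPolynomial (Fin 3) F, f.IsHomogeneous 1 ∧ eval (v i) f ≠ 0 := by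
  obtain ⟨k, hk⟩ := Function.ne_iff.1 (hv.ne_zero i)
  exact ⟨X k, isHomogeneous_X _ _, by simpa using hk⟩

/-- A product of linear forms, one through each point of S and missing v_i, filled up to degree d by
a power of a linear form that is nonzero at v_i. -/
lemma IsPointSystem.exists_separating_finset {v : ι → Fin 3 → F} (hv : IsPointSystem v) {i : ι}
    (S : Finset ι) (hi : i ∉ S) (d : ℕ) (hd : S.card ≤ d) :
    ∃ f : MvPolynomial (Fin 3) F, f.IsHomogeneous d ∧ eval (v i) f ≠ 0 ∧
      ∀ j ∈ S, eval (v j) f = 0 := by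
  classical
  induction S using Finset.induction_on generalizing d with
  | empty =>
    obtain ⟨f, hf, hfi⟩ := hv.exists_eval_ne_zero i
    exact ⟨f ^ d, by simpa using hf.pow d, by simpa using pow_ne_zero d hfi, by simp⟩
  | insert j S hj ih =>
    rw [Finset.card_insert_of_notMem hj] at hd
    obtain ⟨e, rfl⟩ : ∃ e, d = e + 1 := ⟨d - 1, by omega⟩
    rw [Finset.mem_insert, not_or] at hi
    obtain ⟨f, hf, hfi, hfS⟩ := ih hi.2 e (by omega)
    obtain ⟨g, hg, hgi, hgj⟩ := hv.exists_separating hi.1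
    refine ⟨f * g, hf.mul hg, by simp [hfi, hgi], fun k hk => ?_⟩
    rcases Finset.mem_insert.1 hk with rfl | hk
    · simp [hgj]
    · simp [hfS k hk]

lemma IsPointSystem.card_formsOn [Fintype F] {v : ι → Fin 3 → F} (hv : IsPointSystem v)
    (S : Finset ι) (d : ℕ) (hS : S.card ≤ d + 1) :
    (formsOn v d S).card * Fintype.card F ^ S.card = Fintype.card F ^ (d + 2).choose 2 := by
  classical
  refine card_formsOn_mul v d S fun i hi => ?_
  obtain ⟨f, hf, hfi, hfS⟩ := hv.exists_separating_finset (S.erase i) (Finset.notMem_erase i S) d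
    (by rw [Finset.card_erase_of_mem hi]; omega)
  exact ⟨f, hf, hfi, fun j hj hji => hfS j (Finset.mem_erase.2 ⟨hji, hj⟩)⟩

end Points

/-! ### Splitting off the greatest common divisor of a pair of forms -/

lemma IsHomogeneous.le_and_isHomogeneous_of_mul {F : Type*} [Field F] {h a : MvPolynomial (Fin 3) F}
    {d e : ℕ} (he : h.IsHomogeneous e) (h0 : h ≠ 0) (ha : (h * a).IsHomogeneous d) (ha0 : a ≠ 0) :
    e ≤ d ∧ a.IsHomogeneous (d - e) := by
  obtain ⟨k, l, hkl, hk, hl⟩ := isHomogeneous_of_mul ha (mul_ne_zero h0 ha0)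
  obtain rfl := hk.inj_right he h0
  exact ⟨by omega, by rwa [← hkl, Nat.add_sub_cancel_left]⟩

lemma IsHomogeneous.right_of_mul {F : Type*} [Field F] {h a : MvPolynomial (Fin 3) F}
    {d e : ℕ} (he : h.IsHomogeneous e) (h0 : h ≠ 0) (ha : (h * a).IsHomogeneous d) :
    a.IsHomogeneous (d - e) := by
  by_cases ha0 : a = 0
  · rw [ha0]; exact isHomogeneous_zero _ _ _
  · exact (IsHomogeneous.le_and_isHomogeneous_of_mul he h0 ha ha0).2

section Pairs

variable {F : Type*} [Field F] [Fintype F]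

open Classical in
/-- The pairs of forms of degree `d` without a common factor. -/
noncomputable def relPairs (F : Type*) [Field F] [Fintype F] (d : ℕ) :
    Finset (MvPolynomial (Fin 3) F × MvPolynomial (Fin 3) F) :=
  (forms F d ×ˢ forms F d).filter fun p => IsRelPrime p.1 p.2

@[simp]
lemma mem_relPairs {d : ℕ} {p : MvPolynomial (Fin 3) F × MvPolynomial (Fin 3) F} :
    p ∈ relPairs F d ↔ (p.1.IsHomogeneous d ∧ p.2.IsHomogeneous d) ∧ IsRelPrime p.1 p.2 := by
  simp [relPairs]

lemma relPairs_ne_zero {d : ℕ} {p : MvPolynomial (Fin 3) F × MvPolynomial (Fin 3) F}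
    (hp : p ∈ relPairs F d) : p.1 ≠ 0 ∨ p.2 ≠ 0 := by
  by_contra! h
  have := (mem_relPairs.1 hp).2
  rw [h.1, h.2, isRelPrime_zero_left] at this
  exact not_isUnit_zero this

open Classical in
/-- The pairs of forms of degree `d` other than `(0, 0)`. -/
noncomputable def nonzeroPairs (F : Type*) [Field F] [Fintype F] (d : ℕ) :
    Finset (MvPolynomial (Fin 3) F × MvPolynomial (Fin 3) F) :=
  (forms F d ×ˢ forms F d).erase 0

@[simp]
lemma mem_nonzeroPairs {d : ℕ} {p : MvPolynomial (Fin 3) F × MvPolynomial (Fin 3) F} :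
    p ∈ nonzeroPairs F d ↔
      (p.1 ≠ 0 ∨ p.2 ≠ 0) ∧ (p.1.IsHomogeneous d ∧ p.2.IsHomogeneous d) := by
  simp [nonzeroPairs, Prod.ext_iff, imp_iff_not_or]

open Classical in
/-- The nonzero forms of degree `d`. -/
noncomputable def nonzeroForms (F : Type*) [Field F] [Fintype F] (d : ℕ) :
    Finset (MvPolynomial (Fin 3) F) :=
  (forms F d).erase 0

@[simp]
lemma mem_nonzeroForms {d : ℕ} {f : MvPolynomial (Fin 3) F} :
    f ∈ nonzeroForms F d ↔ f ≠ 0 ∧ f.IsHomogeneous d := by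
  simp [nonzeroForms]

/-- The factorizations `(h a, h b)` of pairs of forms of degree `d`, with `a` and `b` coprime. -/
noncomputable def factoredPairs (F : Type*) [Field F] [Fintype F] (d : ℕ) :
    Finset (Σ _ : ℕ, MvPolynomial (Fin 3) F × MvPolynomial (Fin 3) F × MvPolynomial (Fin 3) F) :=
  (Finset.range (d + 1)).sigma fun e => nonzeroForms F e ×ˢ relPairs F (d - e)

lemma mem_factoredPairs {d : ℕ} {t : Σ _ : ℕ, MvPolynomial (Fin 3) F × MvPolynomial (Fin 3) F ×
    MvPolynomial (Fin 3) F} :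
    t ∈ factoredPairs F d ↔ t.1 < d + 1 ∧ t.2.1 ∈ nonzeroForms F t.1 ∧
      t.2.2 ∈ relPairs F (d - t.1) := by
  rw [factoredPairs, Finset.mem_sigma, Finset.mem_range, Finset.mem_product]

-- The multiplicative group of F acts simply transitively on the factorizations of a given pair: u
-- sends (h, a, b) to (u h, a/u, b/u). Transitivity is the uniqueness of the gcd up to a unit, units
-- being constants.
open Classical in
lemma card_factoredPairs_fiber {d : ℕ} {p : MvPolynomial (Fin 3) F × MvPolynomial (Fin 3) F}
    (hp : p ∈ nonzeroPairs F d) :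
    ((factoredPairs F d).filter fun t => (t.2.1 * t.2.2.1, t.2.1 * t.2.2.2) = p).card =
      Fintype.card F - 1 := by
  obtain ⟨f, g⟩ := p
  obtain ⟨hne, hf, hg⟩ := mem_nonzeroPairs.1 hp
  obtain ⟨D, a, b, hfa, hgb, hD0, hab⟩ := exists_gcd f g hne
  simp only at hne hf hg
  have hab0 : a ≠ 0 ∨ b ≠ 0 := by
    rcases hne with h | h
    · left; rintro rfl; simp [hfa] at h
    · right; rintro rfl; simp [hgb] at h
  obtain ⟨e, he⟩ : ∃ e, D.IsHomogeneous e := by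
    rcases hne with h | h
    · rw [hfa] at hf h
      obtain ⟨k, l, -, hk, -⟩ := isHomogeneous_of_mul hf h
      exact ⟨k, hk⟩
    · rw [hgb] at hg h
      obtain ⟨k, l, -, hk, -⟩ := isHomogeneous_of_mul hg h
      exact ⟨k, hk⟩
  rw [hfa] at hf
  rw [hgb] at hg
  have hed : e < d + 1 := Nat.lt_succ_of_le <| hab0.elim
    (fun h => (IsHomogeneous.le_and_isHomogeneous_of_mul he hD0 hf h).1)
    (fun h => (IsHomogeneous.le_and_isHomogeneous_of_mul he hD0 hg h).1)
  have ha := IsHomogeneous.right_of_mul he hD0 hf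
  have hb := IsHomogeneous.right_of_mul he hD0 hg
  let ψ : Fˣ → Σ _ : ℕ, MvPolynomial (Fin 3) F × MvPolynomial (Fin 3) F × MvPolynomial (Fin 3) F :=
    fun u => ⟨e, C (u : F) * D, C ((u⁻¹ : Fˣ) : F) * a, C ((u⁻¹ : Fˣ) : F) * b⟩
  have hψ : Function.Injective ψ := by
    intro u w h
    have h1 : C (u : F) * D = C (w : F) * D := by
      simp only [ψ, Sigma.mk.injEq, heq_eq_eq, true_and, Prod.mk.injEq] at h
      exact h.1
    exact Units.ext (C_injective _ _ (mul_right_cancel₀ hD0 h1))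
  have hC : ∀ u : Fˣ, (C (u : F) * C ((u⁻¹ : Fˣ) : F) : MvPolynomial (Fin 3) F) = 1 := by
    intro u
    rw [← C_mul, Units.mul_inv, C_1]
  have hunit : ∀ u : Fˣ, IsUnit (C (u : F) : MvPolynomial (Fin 3) F) := fun u => u.isUnit.map C
  have himg : ((factoredPairs F d).filter fun t => (t.2.1 * t.2.2.1, t.2.1 * t.2.2.2) = (f, g)) =
      Finset.univ.image ψ := by
    ext t
    simp only [Finset.mem_filter, Finset.mem_image, Finset.mem_univ, true_and, mem_factoredPairs,
      mem_nonzeroForms, mem_relPairs, Prod.mk.injEq]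
    constructor
    · obtain ⟨e', D', a', b'⟩ := t
      rintro ⟨⟨h1, ⟨h2, h3⟩, ⟨h4, h5⟩, h6⟩, h7, h8⟩
      simp only at h1 h2 h3 h4 h5 h6 h7 h8
      obtain ⟨U, hU⟩ := associated_of_mul_eq_mul (hfa.symm.trans h7.symm) (hgb.symm.trans h8.symm)
        hab h6
      obtain ⟨c, hc, hcU⟩ := isUnit_iff_eq_C_of_isReduced.1 U.isUnit
      obtain ⟨u, rfl⟩ := hc
      have hD' : C (u : F) * D = D' := by rw [← hU, hcU, mul_comm]
      have hee : e = e' := (he.C_mul (u : F)).inj_right (by rwa [hD']) (by rwa [hD'])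
      have hq : ∀ {x y z : MvPolynomial (Fin 3) F}, D' * x = z → z = D * y →
          C ((u⁻¹ : Fˣ) : F) * y = x := by
        intro x y z hx hy
        apply mul_left_cancel₀ h2
        rw [hx, hy, ← hD']
        linear_combination (D * y) * hC u
      refine ⟨u, ?_⟩
      simp only [ψ]
      rw [hD', hq h7 hfa, hq h8 hgb, hee]
    · rintro ⟨u, rfl⟩
      simp only [ψ]
      refine ⟨⟨hed, ⟨mul_ne_zero (hunit u).ne_zero hD0, he.C_mul _⟩,
        ⟨ha.C_mul _, hb.C_mul _⟩, ?_⟩, ?_, ?_⟩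
      · rw [isRelPrime_mul_unit_left_left (hunit _), isRelPrime_mul_unit_left_right (hunit _)]
        exact hab
      · rw [hfa]; linear_combination (D * a) * hC u
      · rw [hgb]; linear_combination (D * b) * hC u
  rw [himg, Finset.card_image_of_injective _ hψ, Finset.card_univ, Fintype.card_units]

/-- Every nonzero pair of forms is `q - 1` times a form times a pair of coprime forms. -/
lemma sum_nonzeroPairs (d : ℕ) (φ : MvPolynomial (Fin 3) F → MvPolynomial (Fin 3) F → ℚ) :
    ((Fintype.card F : ℚ) - 1) * ∑ p ∈ nonzeroPairs F d, φ p.1 p.2 =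
      ∑ e ∈ Finset.range (d + 1), ∑ h ∈ nonzeroForms F e, ∑ p ∈ relPairs F (d - e),
        φ (h * p.1) (h * p.2) := by
  classical
  have hmaps : ∀ t ∈ factoredPairs F d,
      (t.2.1 * t.2.2.1, t.2.1 * t.2.2.2) ∈ nonzeroPairs F d := by
    intro t ht
    obtain ⟨h1, h2, h3⟩ := mem_factoredPairs.1 ht
    have h4 := relPairs_ne_zero h3
    rw [mem_nonzeroForms] at h2
    rw [mem_relPairs] at h3
    rw [mem_nonzeroPairs]
    have h5 : t.1 + (d - t.1) = d := by omega
    refine ⟨h4.imp (mul_ne_zero h2.1) (mul_ne_zero h2.1), ?_, ?_⟩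
    · simpa [h5] using h2.2.mul h3.1.1
    · simpa [h5] using h2.2.mul h3.1.2
  have hRHS : ∑ e ∈ Finset.range (d + 1), ∑ h ∈ nonzeroForms F e, ∑ p ∈ relPairs F (d - e),
        φ (h * p.1) (h * p.2) =
      ∑ t ∈ factoredPairs F d, φ (t.2.1 * t.2.2.1) (t.2.1 * t.2.2.2) := by
    rw [factoredPairs, Finset.sum_sigma]
    refine Finset.sum_congr rfl fun e _ => ?_
    rw [Finset.sum_product]
  rw [hRHS, ← Finset.sum_fiberwise_of_maps_to hmaps, Finset.mul_sum]
  refine Finset.sum_congr rfl fun p hp => ?_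
  rw [Finset.sum_congr rfl (g := fun _ => φ p.1 p.2), Finset.sum_const,
    card_factoredPairs_fiber hp, nsmul_eq_mul, Nat.cast_sub Fintype.card_pos, Nat.cast_one]
  intro t ht
  rw [← (Finset.mem_filter.1 ht).2]

end Pairs

/-! ### Coprime forms of degree `d` have at most `d ^ 2` common zeros -/

section Bezout

variable {F : Type*} [Field F] {ι : Type*} [Fintype ι]

open Classical in
/-- The zeros of `f` among the points `v i`. -/
noncomputable def zeros (v : ι → Fin 3 → F) (f : MvPolynomial (Fin 3) F) : Finset ι :=
  Finset.univ.filter fun i => eval (v i) f = 0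

@[simp]
lemma mem_zeros {v : ι → Fin 3 → F} {f : MvPolynomial (Fin 3) F} {i : ι} :
    i ∈ zeros v f ↔ eval (v i) f = 0 := by
  simp [zeros]

open Classical in
/-- The common zeros of a pair of polynomials among the points `v i`. -/
noncomputable def commonZeros (v : ι → Fin 3 → F)
    (p : MvPolynomial (Fin 3) F × MvPolynomial (Fin 3) F) : Finset ι :=
  zeros v p.1 ∩ zeros v p.2

@[simp]
lemma mem_commonZeros {v : ι → Fin 3 → F} {p : MvPolynomial (Fin 3) F × MvPolynomial (Fin 3) F}
    {i : ι} : i ∈ commonZeros v p ↔ eval (v i) p.1 = 0 ∧ eval (v i) p.2 = 0 := by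
  simp [commonZeros]

/-- The second difference, with step d, of the dimension of the space of ternary forms. This is
where the Bézout number d² comes from. -/
lemma choose_second_difference (s d : ℕ) :
    (2 * d + s + 2).choose 2 + (s + 2).choose 2 = 2 * (d + s + 2).choose 2 + d ^ 2 := by
  have h : ∀ n : ℕ, ((n + 2).choose 2) * 2 = (n + 2) * (n + 1) := fun n => by
    rw [Nat.choose_two_right, Nat.div_mul_cancel (Nat.even_mul_pred_self _).two_dvd]
    rfl
  have h1 := h (2 * d + s)
  have h2 := h s
  have h3 := h (d + s)
  nlinarith

/-- Bézout's bound by counting dimensions. With s = |S|, let (a, b) ↦ a f + b g act on pairs of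
forms of degree d + s. Coprimality makes the kernel consist of multiples c (g, -f) with c of degree
s. The image lies in the forms of degree 2d + s vanishing on S, whose codimension is exactly s
because the extra degree s makes the points independent. Comparing dimensions gives s ≤ d². -/
lemma card_commonZeros_le [Fintype F] {v : ι → Fin 3 → F} (hv : IsPointSystem v) {d : ℕ}
    {p : MvPolynomial (Fin 3) F × MvPolynomial (Fin 3) F} (hp : p ∈ relPairs F d) :
    (commonZeros v p).card ≤ d ^ 2 := by
  classical
  obtain ⟨f, g⟩ := p
  obtain ⟨⟨hf, hg⟩, hrel⟩ := mem_relPairs.1 hp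
  simp only at hf hg hrel
  set S := commonZeros v (f, g) with hS
  set s := S.card with hs
  set q := Fintype.card F with hq
  have hq1 : 1 < q := Fintype.one_lt_card
  let V := homogeneousSubmodule (Fin 3) F (d + s)
  let ψ : (V × V) →ₗ[F] MvPolynomial (Fin 3) F :=
    ((LinearMap.mulRight F f).comp V.subtype).coprod ((LinearMap.mulRight F g).comp V.subtype)
  have hψ : ∀ a, ψ a = a.1.1 * f + a.2.1 * g := fun a => by simp [ψ]
  have h1 := card_range_mul_card_ker ψ
  have hV : Nat.card V = q ^ (d + s + 2).choose 2 := by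
    rw [natCard_forms, card_forms]
  rw [Nat.card_prod, hV] at h1
  have h2 : Nat.card (LinearMap.range ψ) * q ^ s ≤ q ^ (2 * d + s + 2).choose 2 := by
    rw [← hv.card_formsOn S (2 * d + s) (by omega)]
    refine Nat.mul_le_mul_right _ ?_
    rw [← Nat.card_eq_finsetCard]
    refine Nat.card_le_card_of_injective (fun x => ⟨x.1, ?_⟩) ?_
    · obtain ⟨a, ha⟩ := x.2
      rw [← ha, hψ, mem_formsOn]
      refine ⟨?_, fun i hi => ?_⟩
      · have e1 : 2 * d + s = d + s + d := by ring
        rw [e1]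
        exact (IsHomogeneous.mul a.1.2 hf).add (IsHomogeneous.mul a.2.2 hg)
      · rw [hS, mem_commonZeros] at hi
        simp only at hi
        simp [hi.1, hi.2]
    · intro x y h
      exact Subtype.ext (by simpa using h)
  have h3 : Nat.card (LinearMap.ker ψ) ≤ q ^ (s + 2).choose 2 := by
    rw [← card_forms, ← natCard_forms]
    have hne : f ≠ 0 ∨ g ≠ 0 := relPairs_ne_zero hp
    have hker : ∀ x : LinearMap.ker ψ, ∃ c : homogeneousSubmodule (Fin 3) F s,
        x.1.1.1 = c.1 * g ∧ x.1.2.1 = - c.1 * f := by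
      rintro ⟨⟨⟨a, ha⟩, ⟨b, hb⟩⟩, hx⟩
      rw [LinearMap.mem_ker, hψ] at hx
      simp only at hx ⊢
      obtain ⟨c, hc, hc'⟩ : ∃ c, a = g * c ∧ b = - c * f := by
        by_cases hg0 : g = 0
        · have hu : IsUnit f := by rwa [hg0, isRelPrime_zero_right] at hrel
          obtain ⟨f', hf'⟩ := hu.exists_right_inv
          refine ⟨-(b * f'), ?_, ?_⟩
          · rw [hg0, zero_mul]
            rw [hg0, mul_zero, add_zero] at hx
            exact (mul_eq_zero.1 hx).resolve_right hu.ne_zero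
          · linear_combination (-b) * hf'
        · obtain ⟨c, hc⟩ : g ∣ a := hrel.symm.dvd_of_dvd_mul_right ⟨-b, by linear_combination hx⟩
          refine ⟨c, hc, mul_right_cancel₀ hg0 ?_⟩
          rw [hc] at hx
          linear_combination hx
      have hcs : c.IsHomogeneous s := by
        rcases hne with h | h
        · rw [hc', show -c * f = -(f * c) by ring] at hb
          have hb' := IsHomogeneous.neg hb
          rw [neg_neg] at hb'
          simpa using IsHomogeneous.right_of_mul hf h hb'
        · rw [hc] at ha
          simpa using IsHomogeneous.right_of_mul hg h ha
      exact ⟨⟨c, hcs⟩, by rw [hc, mul_comm], hc'⟩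
    choose c hc1 hc2 using hker
    refine Nat.card_le_card_of_injective c fun x y h => ?_
    refine Subtype.ext (Prod.ext (Subtype.ext ?_) (Subtype.ext ?_))
    · rw [hc1, hc1, h]
    · rw [hc2, hc2, h]
  have h4 : q ^ (2 * (d + s + 2).choose 2 + s) ≤ q ^ ((2 * d + s + 2).choose 2 + (s + 2).choose 2) := by
    calc q ^ (2 * (d + s + 2).choose 2 + s)
        = (Nat.card (LinearMap.range ψ) * q ^ s) * Nat.card (LinearMap.ker ψ) := by
          rw [pow_add, two_mul, pow_add, ← h1]; ring
      _ ≤ _ := by rw [pow_add]; exact Nat.mul_le_mul h2 h3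
  rw [Nat.pow_le_pow_iff_right hq1] at h4
  have := choose_second_difference s d
  omega

end Bezout

/-! ### Counting points -/

section Counting

variable {F : Type*} [Field F] [Fintype F] {ι : Type*} [Fintype ι] {v : ι → Fin 3 → F}

open Classical in
/-- A property of vectors that only depends on the point holds for `q - 1` times as many nonzero
vectors as points. -/
lemma IsPointSystem.card_filter_vectors (hv : IsPointSystem v) (P : (Fin 3 → F) → Prop)
    (hP : ∀ a : F, a ≠ 0 → ∀ w, P (a • w) ↔ P w) :
    (Finset.univ.filter fun w : Fin 3 → F => w ≠ 0 ∧ P w).card =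
      (Fintype.card F - 1) * (Finset.univ.filter fun i => P (v i)).card := by
  rw [← Fintype.card_units, ← Finset.card_univ, ← Finset.card_product]
  symm
  refine Finset.card_bij (fun x _ => (x.1 : F) • v x.2) ?_ ?_ ?_
  · rintro ⟨u, i⟩ h
    simp only [Finset.mem_product, Finset.mem_univ, Finset.mem_filter, true_and] at h ⊢
    exact ⟨smul_ne_zero u.ne_zero (hv.ne_zero i), (hP _ u.ne_zero _).2 h⟩
  · rintro ⟨u, i⟩ _ ⟨w, j⟩ _ h
    simp only at h
    have hij : i = j := hv.eq_of_smul i j ((u : F)⁻¹ * w) (by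
      rw [mul_smul, ← h, smul_smul, inv_mul_cancel₀ u.ne_zero, one_smul])
    subst hij
    rw [Units.ext (smul_left_injective F (hv.ne_zero i) h)]
  · intro w hw
    simp only [Finset.mem_filter, Finset.mem_univ, true_and] at hw
    obtain ⟨i, a, rfl⟩ := hv.exists_smul w hw.1
    have ha : a ≠ 0 := by rintro rfl; simp at hw
    refine ⟨(Units.mk0 a ha, i), ?_, rfl⟩
    simp only [Finset.mem_product, Finset.mem_univ, Finset.mem_filter, true_and]
    exact (hP a ha _).1 hw.2

-- The summand 1 is the zero vector, which is a zero because d ≠ 0.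
open Classical in
lemma IsPointSystem.card_zeros (hv : IsPointSystem v) {d : ℕ} (hd : d ≠ 0)
    {f : MvPolynomial (Fin 3) F} (hf : f.IsHomogeneous d) :
    (Finset.univ.filter fun w : Fin 3 → F => eval w f = 0).card =
      (Fintype.card F - 1) * (zeros v f).card + 1 := by
  have h0 : eval (0 : Fin 3 → F) f = 0 := by
    have := eval_smul_of_isHomogeneous hf 0 0
    rwa [zero_smul, zero_pow hd, zero_mul] at this
  have h1 := hv.card_filter_vectors (fun w => eval w f = 0) (fun a ha w => by
    rw [eval_smul_of_isHomogeneous hf, mul_eq_zero, or_iff_right (pow_ne_zero _ ha)])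
  rw [zeros, ← h1, ← Finset.card_erase_add_one (a := (0 : Fin 3 → F)) (by simpa using h0)]
  congr 2
  ext w
  simp

lemma IsPointSystem.card_points (hv : IsPointSystem v) :
    Fintype.card ι = Fintype.card F ^ 2 + Fintype.card F + 1 := by
  classical
  -- For the zero linear form every vector is a zero, so q^3 = (q - 1) |ι| + 1.
  have h := hv.card_zeros one_ne_zero (isHomogeneous_zero (Fin 3) F 1)
  have h1 : zeros v (0 : MvPolynomial (Fin 3) F) = Finset.univ := by ext; simp
  rw [h1] at h
  simp only [map_zero, Finset.filter_true, Finset.card_univ, Fintype.card_fun,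
    Fintype.card_fin] at h
  obtain ⟨r, hr⟩ : ∃ r, Fintype.card F = r + 2 :=
    ⟨Fintype.card F - 2, by have := Fintype.one_lt_card (α := F); omega⟩
  rw [hr] at h ⊢
  rw [show r + 2 - 1 = r + 1 by omega] at h
  refine Nat.eq_of_mul_eq_mul_left (Nat.succ_pos r) ?_
  rw [Nat.succ_eq_add_one]
  nlinarith

omit [Fintype F] in
lemma exists_linearMap_eval {f : MvPolynomial (Fin 3) F} (hf : f.IsHomogeneous 1) :
    ∃ φ : (Fin 3 → F) →ₗ[F] F, ∀ w, φ w = eval w f := by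
  rw [← mem_homogeneousSubmodule, homogeneousSubmodule_one_eq_span_X] at hf
  induction hf using Submodule.span_induction with
  | mem x hx =>
    obtain ⟨k, rfl⟩ := hx
    exact ⟨LinearMap.proj k, fun w => by simp⟩
  | zero => exact ⟨0, fun w => by simp⟩
  | add x y _ _ hx hy =>
    obtain ⟨φ, hφ⟩ := hx
    obtain ⟨ψ, hψ⟩ := hy
    exact ⟨φ + ψ, fun w => by simp [hφ, hψ]⟩
  | smul a x _ hx =>
    obtain ⟨φ, hφ⟩ := hx
    exact ⟨a • φ, fun w => by simp [hφ, smul_eval]⟩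

-- The bound d ≤ q is sharp, since x^q y - x y^q vanishes everywhere. For cubics it is the
-- assumption q > 2.
omit [Fintype ι] in
lemma IsPointSystem.eq_zero_of_forall_eval (hv : IsPointSystem v) {d : ℕ} (hd : d ≠ 0)
    (hdF : d ≤ Fintype.card F) {f : MvPolynomial (Fin 3) F} (hf : f.IsHomogeneous d)
    (h : ∀ i, eval (v i) f = 0) : f = 0 := by
  refine hf.eq_zero_of_forall_eval_eq_zero_of_le_card (fun w => ?_)
    (by rw [Cardinal.mk_fintype]; exact_mod_cast hdF)
  by_cases hw : w = 0
  · have := eval_smul_of_isHomogeneous hf 0 0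
    rwa [zero_smul, zero_pow hd, zero_mul, ← hw] at this
  · obtain ⟨i, a, rfl⟩ := hv.exists_smul w hw
    rw [eval_smul_of_isHomogeneous hf, h, mul_zero]

open Classical in
lemma card_ker_of_ne_zero {φ : (Fin 3 → F) →ₗ[F] F} (hφ : φ ≠ 0) :
    (Finset.univ.filter fun w => φ w = 0).card = Fintype.card F ^ 2 := by
  have h1 := card_range_mul_card_ker φ
  have h2 : LinearMap.range φ = ⊤ := LinearMap.range_eq_top.2 (LinearMap.surjective hφ)
  rw [h2, Nat.card_congr Submodule.topEquiv.toEquiv] at h1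
  have h3 : Nat.card (LinearMap.ker φ) = (Finset.univ.filter fun w => φ w = 0).card := by
    rw [← Nat.card_eq_finsetCard]
    exact Nat.card_congr (Equiv.subtypeEquivRight (by simp))
  rw [h3, Nat.card_eq_fintype_card, Nat.card_eq_fintype_card, Fintype.card_fun,
    Fintype.card_fin] at h1
  refine Nat.eq_of_mul_eq_mul_left (Fintype.card_pos (α := F)) ?_
  rw [h1]; ring

/-- A line has `q + 1` points. -/
lemma IsPointSystem.card_zeros_linear (hv : IsPointSystem v) {f : MvPolynomial (Fin 3) F}
    (hf : f ∈ nonzeroForms F 1) : (zeros v f).card = Fintype.card F + 1 := by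
  classical
  obtain ⟨hf0, hf1⟩ := mem_nonzeroForms.1 hf
  obtain ⟨φ, hφ⟩ := exists_linearMap_eval hf1
  have hφ0 : φ ≠ 0 := by
    rintro rfl
    refine hf0 (hv.eq_zero_of_forall_eval one_ne_zero Fintype.card_pos hf1 fun i => ?_)
    rw [← hφ, LinearMap.zero_apply]
  have h1 := hv.card_zeros one_ne_zero hf1
  have h2 := card_ker_of_ne_zero hφ0
  simp only [hφ] at h2
  rw [h2] at h1
  obtain ⟨r, hr⟩ : ∃ r, Fintype.card F = r + 2 :=
    ⟨Fintype.card F - 2, by have := Fintype.one_lt_card (α := F); omega⟩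
  rw [hr] at h1 ⊢
  rw [show r + 2 - 1 = r + 1 by omega] at h1
  refine Nat.eq_of_mul_eq_mul_left (Nat.succ_pos r) ?_
  rw [Nat.succ_eq_add_one]
  nlinarith

omit [Fintype F] in
lemma zeros_mul (f g : MvPolynomial (Fin 3) F) [DecidableEq ι] :
    zeros v (f * g) = zeros v f ∪ zeros v g := by
  ext i
  simp

omit [Fintype F] in
lemma commonZeros_mul (h : MvPolynomial (Fin 3) F)
    (p : MvPolynomial (Fin 3) F × MvPolynomial (Fin 3) F) [DecidableEq ι] :
    commonZeros v (h * p.1, h * p.2) = zeros v h ∪ commonZeros v p := by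
  ext i
  simp only [mem_commonZeros, Finset.mem_union, mem_zeros, map_mul, mul_eq_zero]
  tauto

lemma zeros_of_mem_nonzeroForms_zero {f : MvPolynomial (Fin 3) F} (hf : f ∈ nonzeroForms F 0) :
    zeros v f = ∅ := by
  obtain ⟨h0, hf⟩ := mem_nonzeroForms.1 hf
  ext i
  simp only [mem_zeros, Finset.notMem_empty, iff_false]
  exact ((isUnit_of_isHomogeneous_zero hf h0).map (eval (v i))).ne_zero

lemma commonZeros_of_mem_relPairs_zero (hv : IsPointSystem v)
    {p : MvPolynomial (Fin 3) F × MvPolynomial (Fin 3) F} (hp : p ∈ relPairs F 0) :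
    commonZeros v p = ∅ := by
  have := card_commonZeros_le hv hp
  simpa using this

lemma card_nonzeroForms (d : ℕ) :
    ((nonzeroForms F d).card : ℚ) = (Fintype.card F : ℚ) ^ (d + 2).choose 2 - 1 := by
  classical
  rw [nonzeroForms, Finset.card_erase_of_mem (by simpa using isHomogeneous_zero _ _ _), card_forms,
    Nat.cast_sub (Nat.one_le_pow _ _ Fintype.card_pos)]
  simp

lemma card_nonzeroPairs (d : ℕ) :
    ((nonzeroPairs F d).card : ℚ) = ((Fintype.card F : ℚ) ^ (d + 2).choose 2) ^ 2 - 1 := by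
  classical
  rw [nonzeroPairs, Finset.card_erase_of_mem, Finset.card_product, card_forms,
    Nat.cast_sub (Nat.mul_pos (pow_pos Fintype.card_pos _) (pow_pos Fintype.card_pos _))]
  · push_cast; ring
  · simp only [Finset.mem_product, mem_forms, Prod.fst_zero, Prod.snd_zero, and_self]
    exact isHomogeneous_zero _ _ _

lemma one_lt_cardQ : (1 : ℚ) < Fintype.card F := by exact_mod_cast Fintype.one_lt_card (α := F)

lemma card_relPairs_zero : ((relPairs F 0).card : ℚ) = (Fintype.card F : ℚ) ^ 2 - 1 := by
  have h := sum_nonzeroPairs (F := F) 0 (fun _ _ => 1)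
  simp only [Finset.sum_const, nsmul_eq_mul, mul_one, zero_add, Finset.range_one,
    Finset.sum_singleton, card_nonzeroPairs, card_nonzeroForms, Nat.sub_zero, Nat.choose_self,
    pow_one] at h
  exact (mul_left_cancel₀ (sub_ne_zero.2 one_lt_cardQ.ne') h).symm

/-- The decomposition `sum_nonzeroPairs` for functions of the set of common zeros. -/
lemma sum_nonzeroPairs_commonZeros [DecidableEq ι] (v : ι → Fin 3 → F) (d : ℕ) (Φ : Finset ι → ℚ) :
    ((Fintype.card F : ℚ) - 1) * ∑ p ∈ nonzeroPairs F d, Φ (commonZeros v p) =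
      ∑ e ∈ Finset.range (d + 1), ∑ h ∈ nonzeroForms F e, ∑ p ∈ relPairs F (d - e),
        Φ (zeros v h ∪ commonZeros v p) := by
  have := sum_nonzeroPairs (F := F) d (fun f g => Φ (commonZeros v (f, g)))
  simpa only [commonZeros_mul] using this

omit [Fintype ι] in
/-- Counting the `k`-subsets of `A` inside the members of a finite family of sets. -/
lemma sum_choose_card_inter {α : Type*} [DecidableEq ι] (T : Finset α) (Z : α → Finset ι)
    (A : Finset ι) (k : ℕ) :
    ∑ t ∈ T, (((Z t ∩ A).card.choose k : ℕ) : ℚ) =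
      ∑ S ∈ A.powersetCard k, ((T.filter fun t => S ⊆ Z t).card : ℚ) := by
  have h : ∀ t, (((Z t ∩ A).card.choose k : ℕ) : ℚ) =
      ∑ S ∈ A.powersetCard k, if S ⊆ Z t then 1 else 0 := by
    intro t
    rw [Finset.sum_boole, ← Finset.card_powersetCard]
    congr 2
    ext S
    simp only [Finset.mem_powersetCard, Finset.mem_filter, Finset.subset_inter_iff]
    tauto
  simp only [h, Finset.natCast_card_filter]
  exact Finset.sum_comm

end Counting

/-! ### Pairs of lines -/

section Lines

variable {F : Type*} [Field F] [Fintype F] {ι : Type*} [Fintype ι] {v : ι → Fin 3 → F}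

/-- The term of `sum_nonzeroPairs_commonZeros` with constant gcd. -/
lemma sum_zero_forms [DecidableEq ι] (v : ι → Fin 3 → F) (d : ℕ) (Φ : Finset ι → ℚ) :
    ∑ h ∈ nonzeroForms F 0, ∑ p ∈ relPairs F d, Φ (zeros v h ∪ commonZeros v p) =
      ((Fintype.card F : ℚ) - 1) * ∑ p ∈ relPairs F d, Φ (commonZeros v p) := by
  rw [Finset.sum_congr rfl (g := fun _ => ∑ p ∈ relPairs F d, Φ (commonZeros v p)),
    Finset.sum_const, nsmul_eq_mul, card_nonzeroForms]
  · simp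
  · intro h hh
    rw [zeros_of_mem_nonzeroForms_zero hh]
    simp

/-- The term of proportional pairs: the cofactors are two constants, not both zero, and add no
common zeros. -/
lemma IsPointSystem.sum_zero_pairs [DecidableEq ι] (hv : IsPointSystem v) (d : ℕ)
    (Φ : Finset ι → ℚ) :
    ∑ h ∈ nonzeroForms F d, ∑ p ∈ relPairs F 0, Φ (zeros v h ∪ commonZeros v p) =
      ((Fintype.card F : ℚ) ^ 2 - 1) * ∑ h ∈ nonzeroForms F d, Φ (zeros v h) := by
  rw [Finset.mul_sum]
  refine Finset.sum_congr rfl fun h _ => ?_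
  rw [Finset.sum_congr rfl (g := fun _ => Φ (zeros v h)), Finset.sum_const, nsmul_eq_mul,
    card_relPairs_zero]
  intro p hp
  rw [commonZeros_of_mem_relPairs_zero hv hp, Finset.union_empty]

lemma IsPointSystem.sum_relPairs_one (hv : IsPointSystem v) (Φ : Finset ι → ℚ) :
    ∑ p ∈ relPairs F 1, Φ (commonZeros v p) = ∑ p ∈ nonzeroPairs F 1, Φ (commonZeros v p) -
      ((Fintype.card F : ℚ) + 1) * ∑ h ∈ nonzeroForms F 1, Φ (zeros v h) := by
  classical
  have h := sum_nonzeroPairs_commonZeros v 1 Φ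
  rw [Finset.sum_range_succ, Finset.sum_range_one, sum_zero_forms, Nat.sub_self,
    hv.sum_zero_pairs] at h
  refine mul_left_cancel₀ (sub_ne_zero.2 (one_lt_cardQ (F := F)).ne') ?_
  linear_combination -h

/-- From all pairs of conics, the proportional pairs and those whose gcd is a line are removed. -/
lemma IsPointSystem.sum_relPairs_two [DecidableEq ι] (hv : IsPointSystem v) (Φ : Finset ι → ℚ) :
    ((Fintype.card F : ℚ) - 1) * ∑ p ∈ relPairs F 2, Φ (commonZeros v p) =
      ((Fintype.card F : ℚ) - 1) * (∑ p ∈ nonzeroPairs F 2, Φ (commonZeros v p) -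
        ((Fintype.card F : ℚ) + 1) * ∑ h ∈ nonzeroForms F 2, Φ (zeros v h)) -
      ∑ h ∈ nonzeroForms F 1, ∑ p ∈ relPairs F 1, Φ (zeros v h ∪ commonZeros v p) := by
  have h := sum_nonzeroPairs_commonZeros v 2 Φ
  rw [Finset.sum_range_succ, Finset.sum_range_succ, Finset.sum_range_one, sum_zero_forms,
    Nat.sub_self, hv.sum_zero_pairs] at h
  linear_combination -h

lemma card_nonzeroForms_filter [DecidableEq ι] (v : ι → Fin 3 → F) (d : ℕ) (S : Finset ι) :
    (((nonzeroForms F d).filter fun f => S ⊆ zeros v f).card : ℚ) = (formsOn v d S).card - 1 := by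
  classical
  have h0 : 0 ∈ formsOn v d S := by simpa using isHomogeneous_zero _ _ _
  have : (nonzeroForms F d).filter (fun f => S ⊆ zeros v f) = (formsOn v d S).erase 0 := by
    ext f
    simp [Finset.subset_iff, and_assoc]
  rw [this, Finset.card_erase_of_mem h0, Nat.cast_sub (Finset.card_pos.2 ⟨0, h0⟩), Nat.cast_one]

lemma card_nonzeroPairs_filter [DecidableEq ι] (v : ι → Fin 3 → F) (d : ℕ) (S : Finset ι) :
    (((nonzeroPairs F d).filter fun p => S ⊆ commonZeros v p).card : ℚ) =
      ((formsOn v d S).card : ℚ) ^ 2 - 1 := by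
  classical
  have h0 : 0 ∈ formsOn v d S ×ˢ formsOn v d S := by
    simpa using isHomogeneous_zero _ _ _
  have : (nonzeroPairs F d).filter (fun p => S ⊆ commonZeros v p) =
      (formsOn v d S ×ˢ formsOn v d S).erase 0 := by
    ext p
    simp only [Finset.mem_filter, mem_nonzeroPairs, Finset.subset_iff, mem_commonZeros,
      Finset.mem_erase, Finset.mem_product, mem_formsOn, ne_eq, Prod.ext_iff, Prod.fst_zero,
      Prod.snd_zero, not_and_or]
    grind
  rw [this, Finset.card_erase_of_mem h0, Nat.cast_sub (Finset.card_pos.2 ⟨0, h0⟩), Nat.cast_one,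
    Finset.card_product]
  push_cast
  ring

omit [Fintype ι] in
lemma IsPointSystem.card_formsOn_singleton (hv : IsPointSystem v) (i : ι) :
    (formsOn v 1 {i}).card = Fintype.card F ^ 2 := by
  have h := hv.card_formsOn {i} 1 (by simp)
  rw [Finset.card_singleton, pow_one] at h
  refine Nat.eq_of_mul_eq_mul_right (Fintype.card_pos (α := F)) ?_
  rw [h]
  norm_num [Nat.choose]
  ring

-- Since the count does not depend on i, the meeting point of two distinct lines is equidistributed.
open Classical in
lemma IsPointSystem.card_relPairs_one_filter (hv : IsPointSystem v) (i : ι) :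
    (((relPairs F 1).filter fun p => i ∈ commonZeros v p).card : ℚ) =
      ((Fintype.card F : ℚ) ^ 2 - 1) * ((Fintype.card F : ℚ) ^ 2 - Fintype.card F) := by
  have h := hv.sum_relPairs_one (fun W => if {i} ⊆ W then 1 else 0)
  simp only [← Finset.natCast_card_filter, card_nonzeroForms_filter, card_nonzeroPairs_filter,
    hv.card_formsOn_singleton] at h
  simp only [Finset.singleton_subset_iff] at h
  rw [h]
  push_cast
  ring

/-- Two distinct lines meet in exactly one point. -/
lemma IsPointSystem.card_commonZeros_one (hv : IsPointSystem v)
    {p : MvPolynomial (Fin 3) F × MvPolynomial (Fin 3) F} (hp : p ∈ relPairs F 1) :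
    (commonZeros v p).card = 1 := by
  classical
  -- Double counting shows that the average number of common zeros is 1, while Bézout bounds each
  -- number by 1. A vanishing sum of nonnegative terms has only zero terms.
  have h1 : ∑ p ∈ relPairs F 1, (1 - ((commonZeros v p).card : ℚ)) = 0 := by
    have h2 : ∑ p ∈ relPairs F 1, ((commonZeros v p).card : ℚ) =
        ∑ i : ι, (((relPairs F 1).filter fun p => i ∈ commonZeros v p).card : ℚ) := by
      simp only [Finset.natCast_card_filter]
      rw [Finset.sum_comm]
      refine Finset.sum_congr rfl fun p _ => ?_
      rw [← Finset.natCast_card_filter, Finset.filter_mem_eq_inter, Finset.univ_inter]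
    have h3 := hv.sum_relPairs_one (fun _ => 1)
    simp only [Finset.sum_const, nsmul_eq_mul, mul_one, card_nonzeroPairs,
      card_nonzeroForms] at h3
    rw [Finset.sum_sub_distrib, h2]
    simp only [hv.card_relPairs_one_filter, Finset.sum_const, nsmul_eq_mul, mul_one, h3,
      Finset.card_univ, hv.card_points]
    norm_num [Nat.choose]
    ring
  rw [Finset.sum_eq_zero_iff_of_nonneg] at h1
  · have := h1 p hp
    have h2 : ((commonZeros v p).card : ℚ) = 1 := by linarith
    exact_mod_cast h2
  · intro p hp
    have h2 : ((commonZeros v p).card : ℚ) ≤ 1 := by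
      exact_mod_cast (card_commonZeros_le hv hp).trans_eq (one_pow 2)
    linarith

lemma IsPointSystem.sum_relPairs_one_points (hv : IsPointSystem v) (Φ : Finset ι → ℚ) :
    ∑ p ∈ relPairs F 1, Φ (commonZeros v p) =
      ((Fintype.card F : ℚ) ^ 2 - 1) * ((Fintype.card F : ℚ) ^ 2 - Fintype.card F) *
        ∑ i, Φ {i} := by
  classical
  have h1 : ∀ p ∈ relPairs F 1, Φ (commonZeros v p) =
      ∑ i, if i ∈ commonZeros v p then Φ {i} else 0 := by
    intro p hp
    obtain ⟨i, hi⟩ := Finset.card_eq_one.1 (hv.card_commonZeros_one hp)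
    simp [hi]
  rw [Finset.sum_congr rfl h1, Finset.sum_comm, Finset.mul_sum]
  refine Finset.sum_congr rfl fun i _ => ?_
  rw [← hv.card_relPairs_one_filter i, Finset.natCast_card_filter, Finset.sum_mul]
  exact Finset.sum_congr rfl fun p _ => by split_ifs <;> simp

/-- The meeting point of the two lines raises the count by one exactly when it lies in A \ Z. -/
lemma IsPointSystem.sum_relPairs_one_union [DecidableEq ι] (hv : IsPointSystem v) (Z A : Finset ι)
    (ψ : ℕ → ℚ) :
    ∑ p ∈ relPairs F 1, ψ ((Z ∪ commonZeros v p) ∩ A).card =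
      ((Fintype.card F : ℚ) ^ 2 - 1) * ((Fintype.card F : ℚ) ^ 2 - Fintype.card F) *
        (((Fintype.card ι : ℚ) - A.card + (Z ∩ A).card) * ψ (Z ∩ A).card +
          ((A.card : ℚ) - (Z ∩ A).card) * ψ ((Z ∩ A).card + 1)) := by
  rw [hv.sum_relPairs_one_points (fun W => ψ ((Z ∪ W) ∩ A).card)]
  congr 1
  have h1 : ∀ i, ψ ((Z ∪ {i}) ∩ A).card =
      if i ∈ A \ Z then ψ ((Z ∩ A).card + 1) else ψ (Z ∩ A).card := by
    intro i
    split_ifs with h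
    · rw [Finset.mem_sdiff] at h
      rw [Finset.union_inter_distrib_right, Finset.singleton_inter_of_mem h.1,
        Finset.card_union_of_disjoint, Finset.card_singleton]
      simp [h.2]
    · congr 2
      ext j
      simp only [Finset.mem_inter, Finset.mem_union, Finset.mem_singleton, Finset.mem_sdiff] at h ⊢
      grind
  have h2 : ((A \ Z).card : ℚ) = A.card - (Z ∩ A).card := by
    have := Finset.card_sdiff_add_card_inter A Z
    rw [Finset.inter_comm] at this
    rw [← this]; push_cast; ring
  simp only [h1]
  rw [Finset.sum_ite, Finset.sum_const, Finset.sum_const, nsmul_eq_mul, nsmul_eq_mul,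
    Finset.filter_mem_eq_inter, Finset.univ_inter, h2]
  have h3 := Finset.card_filter_add_card_filter_not (s := (Finset.univ : Finset ι)) (fun i => i ∈ A \ Z)
  rw [Finset.filter_mem_eq_inter, Finset.univ_inter, Finset.card_univ] at h3
  have h4 : ((Finset.univ.filter fun i => ¬ i ∈ A \ Z).card : ℚ) =
      Fintype.card ι - A.card + (Z ∩ A).card := by
    have : ((A \ Z).card : ℚ) + ((Finset.univ.filter fun i => ¬ i ∈ A \ Z).card : ℚ) =
      Fintype.card ι := by exact_mod_cast h3
    linarith
  rw [h4]
  ring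

end Lines

/-! ### The number of points on a conic -/

section Conics

variable {F : Type*} [Field F]

/-- The polar form of a quadratic form. -/
lemma exists_polar {f : MvPolynomial (Fin 3) F} (hf : f.IsHomogeneous 2) :
    ∃ B : (Fin 3 → F) →ₗ[F] (Fin 3 → F) →ₗ[F] F,
      ∀ u w, eval (u + w) f = eval u f + eval w f + B u w := by
  -- Quadratic forms are sums of products of linear forms. The polar form of a product needs no
  -- division by 2, so characteristic 2 is included.
  rw [← mem_homogeneousSubmodule, ← homogeneousSubmodule_one_pow, pow_two] at hf
  induction hf using Submodule.mul_induction_on' with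
  | mem_mul_mem l hl m hm =>
    obtain ⟨φ, hφ⟩ := exists_linearMap_eval hl
    obtain ⟨ψ, hψ⟩ := exists_linearMap_eval hm
    refine ⟨LinearMap.mk₂ F (fun u w => φ u * ψ w + φ w * ψ u) ?_ ?_ ?_ ?_, fun u w => ?_⟩
    · intros; simp only [map_add]; ring
    · intros; simp only [map_smul, smul_eq_mul]; ring
    · intros; simp only [map_add]; ring
    · intros; simp only [map_smul, smul_eq_mul]; ring
    · simp only [map_mul, ← hφ, ← hψ, map_add, LinearMap.mk₂_apply]; ring
  | add x _ y _ hx hy =>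
    obtain ⟨B, hB⟩ := hx
    obtain ⟨C, hC⟩ := hy
    refine ⟨B + C, fun u w => ?_⟩
    simp only [map_add, hB, hC, LinearMap.add_apply]
    ring

variable [Fintype F]

open Classical in
/-- The number of zeros of a quadratic form with a zero that is not a radical vector. -/
lemma card_zeros_of_polar_ne_zero {f : MvPolynomial (Fin 3) F} (hf : f.IsHomogeneous 2)
    {B : (Fin 3 → F) →ₗ[F] (Fin 3 → F) →ₗ[F] F}
    (hB : ∀ u w, eval (u + w) f = eval u f + eval w f + B u w) {u : Fin 3 → F}
    (hu : eval u f = 0) (hBu : B u ≠ 0) :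
    (Finset.univ.filter fun w : Fin 3 → F => eval w f = 0).card = Fintype.card F ^ 2 ∨
    (Finset.univ.filter fun w : Fin 3 → F => eval w f = 0).card + Fintype.card F =
      2 * Fintype.card F ^ 2 := by
  set q := Fintype.card F with hq
  have hu0 : u ≠ 0 := by rintro rfl; simp at hBu
  have hsmul : ∀ (a : F) w, eval (a • w) f = a ^ 2 * eval w f := eval_smul_of_isHomogeneous hf
  have htrans : ∀ (x : F) w, eval (x • u + w) f = eval w f + x * B u w := by
    intro x w
    rw [hB, hsmul, hu, map_smul, LinearMap.smul_apply, smul_eq_mul]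
    ring
  have hBuu : B u u = 0 := by
    have h1 := hB u u
    have h2 := hsmul 2 u
    rw [two_smul, hu, mul_zero] at h2
    rw [hu, h2] at h1
    simpa using h1.symm
  set K := Finset.univ.filter fun w => B u w = 0 with hK
  have hKcard : K.card = q ^ 2 := card_ker_of_ne_zero hBu
  set Z := Finset.univ.filter fun w : Fin 3 → F => eval w f = 0 with hZ
  -- Zeros are counted along the translates x u + w, where f(x u + w) = f(w) + x B(u, w). If B(u, w)
  -- ≠ 0, exactly one x gives a zero; if w lies in K, the value does not depend on x.
  have hcount : q * Z.card = (q ^ 3 - q ^ 2) + q * (K.filter fun w => eval w f = 0).card := by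
    have h1 : ∑ x : F, ∑ w : Fin 3 → F, (if eval (x • u + w) f = 0 then 1 else 0) =
        q * Z.card := by
      rw [Finset.sum_congr rfl (g := fun _ => Z.card), Finset.sum_const, Finset.card_univ,
        smul_eq_mul]
      intro x _
      rw [hZ, Finset.card_filter]
      exact Fintype.sum_equiv (Equiv.addLeft (x • u)) _ _ (fun w => rfl)
    rw [← h1, Finset.sum_comm, ← Finset.sum_filter_add_sum_filter_not _ (fun w => B u w = 0),
      add_comm]
    congr 1
    · rw [Finset.sum_congr rfl (g := fun _ => 1), Finset.sum_const, smul_eq_mul, mul_one]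
      · have := Finset.card_filter_add_card_filter_not (s := (Finset.univ : Finset (Fin 3 → F)))
          (fun w => B u w = 0)
        rw [← hK, hKcard, Finset.card_univ, Fintype.card_fun, Fintype.card_fin, ← hq] at this
        omega
      · intro w hw
        have hw' : B u w ≠ 0 := (Finset.mem_filter.1 hw).2
        rw [← Finset.card_filter, Finset.card_eq_one]
        refine ⟨- eval w f / B u w, ?_⟩
        ext x
        simp only [Finset.mem_filter, Finset.mem_univ, true_and, Finset.mem_singleton, htrans]
        rw [eq_div_iff hw']
        constructor <;> intro h <;> linear_combination h
    · rw [Finset.card_filter, Finset.mul_sum]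
      refine Finset.sum_congr rfl fun w hw => ?_
      have hw' : B u w = 0 := (Finset.mem_filter.1 hw).2
      simp only [htrans, hw', mul_zero, add_zero]
      split_ifs <;> simp [hq]
  have hq0 : 0 < q := Fintype.card_pos
  -- K is a plane containing u. If f does not vanish on K, then f(x u + s w₀) = s² f(w₀) with f(w₀)
  -- ≠ 0, so its zeros on K are the multiples of u.
  have hK2 : (K.filter fun w => eval w f = 0).card = q ∨
      (K.filter fun w => eval w f = 0).card = q ^ 2 := by
    by_cases hall : ∀ w ∈ K, eval w f = 0
    · right
      rw [Finset.filter_true_of_mem hall, hKcard]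
    · left
      push Not at hall
      obtain ⟨w₀, hw₀K, hw₀⟩ := hall
      have hw₀B : B u w₀ = 0 := (Finset.mem_filter.1 hw₀K).2
      have hev : ∀ s x : F, eval (x • u + s • w₀) f = s ^ 2 * eval w₀ f := by
        intro s x
        rw [htrans, hsmul, map_smul, hw₀B, smul_zero, mul_zero, add_zero]
      have hinj : Function.Injective fun x : F × F => x.2 • u + x.1 • w₀ := by
        rintro ⟨s, x⟩ ⟨t, y⟩ h
        simp only at h
        have h1 : (x - y) • u + (s - t) • w₀ = 0 := by
          rw [sub_smul, sub_smul]
          have := sub_eq_zero.2 h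
          rw [← this]; abel
        have h2 := hev (s - t) (x - y)
        rw [h1, ← zero_smul F (0 : Fin 3 → F), hsmul] at h2
        have h3 : s - t = 0 := by simpa [hw₀] using h2.symm
        rw [h3, zero_smul, add_zero] at h1
        have h4 : x - y = 0 := (smul_eq_zero.1 h1).resolve_right hu0
        rw [sub_eq_zero.1 h3, sub_eq_zero.1 h4]
      have himg : Finset.univ.image (fun x : F × F => x.2 • u + x.1 • w₀) = K := by
        refine Finset.eq_of_subset_of_card_le ?_ ?_
        · intro w hw
          obtain ⟨⟨s, x⟩, -, rfl⟩ := Finset.mem_image.1 hw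
          simp [hK, hBuu, hw₀B]
        · rw [Finset.card_image_of_injective _ hinj, hKcard, Finset.card_univ, Fintype.card_prod,
            pow_two]
      have : (K.filter fun w => eval w f = 0) = Finset.univ.image fun x : F => x • u := by
        ext w
        simp only [Finset.mem_filter, Finset.mem_image, Finset.mem_univ, true_and]
        constructor
        · rintro ⟨hwK, hw⟩
          rw [← himg] at hwK
          obtain ⟨⟨s, x⟩, -, rfl⟩ := Finset.mem_image.1 hwK
          simp only at hw
          rw [hev] at hw
          have hs : s = 0 := by simpa [hw₀] using hw
          exact ⟨x, by simp [hs]⟩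
        · rintro ⟨x, rfl⟩
          simp [hK, hBuu, hsmul, hu]
      rw [this, Finset.card_image_of_injective _ (smul_left_injective F hu0), Finset.card_univ]
  have hsub : q ^ 3 - q ^ 2 = q * (q ^ 2 - q) := by rw [Nat.mul_sub]; ring_nf
  rw [hsub, ← mul_add] at hcount
  have hZc := Nat.eq_of_mul_eq_mul_left hq0 hcount
  have hle : q ≤ q ^ 2 := Nat.le_self_pow two_ne_zero q
  rcases hK2 with h | h
  · left; omega
  · right; omega

/-- If some zero is not a radical vector of the polar form, `card_zeros_of_polar_ne_zero` gives q +
1 or 2q + 1 points. Otherwise the zeros form a subspace, of dimension 1 or 2. No classification of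
quadratic forms is needed. -/
lemma IsPointSystem.card_zeros_conic {ι : Type*} [Fintype ι] {v : ι → Fin 3 → F}
    (hv : IsPointSystem v) {f : MvPolynomial (Fin 3) F} (hf : f ∈ nonzeroForms F 2) :
    (zeros v f).card = 1 ∨ (zeros v f).card = Fintype.card F + 1 ∨
      (zeros v f).card = 2 * Fintype.card F + 1 := by
  classical
  obtain ⟨hf0, hf2⟩ := mem_nonzeroForms.1 hf
  obtain ⟨B, hB⟩ := exists_polar hf2
  have hcard := hv.card_zeros two_ne_zero hf2
  obtain ⟨r, hr⟩ : ∃ r, Fintype.card F = r + 2 :=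
    ⟨Fintype.card F - 2, by have := Fintype.one_lt_card (α := F); omega⟩
  have hr1 : Fintype.card F - 1 = r + 1 := by omega
  rw [hr1] at hcard
  have hcancel : ∀ n, (r + 1) * (zeros v f).card = (r + 1) * n → (zeros v f).card = n :=
    fun n h => Nat.eq_of_mul_eq_mul_left (Nat.succ_pos r) h
  by_cases hcase : ∃ u, eval u f = 0 ∧ B u ≠ 0
  · obtain ⟨u, hu, hBu⟩ := hcase
    right
    rcases card_zeros_of_polar_ne_zero hf2 hB hu hBu with h | h
    · left
      rw [h, hr] at hcard
      exact hcancel _ (by rw [hr]; nlinarith)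
    · right
      rw [hcard, hr] at h
      exact hcancel _ (by rw [hr]; nlinarith)
  · push Not at hcase
    have hsmul : ∀ (a : F) w, eval (a • w) f = a ^ 2 * eval w f := eval_smul_of_isHomogeneous hf2
    let M : Submodule F (Fin 3 → F) :=
      { carrier := {w | eval w f = 0}
        add_mem' := by
          intro u w hu hw
          simp only [Set.mem_ofPred_eq] at hu hw ⊢
          rw [hB, hu, hw, hcase u hu]; simp
        zero_mem' := by
          have := hsmul 0 0
          simpa using this
        smul_mem' := by
          intro a w hw
          simp only [Set.mem_ofPred_eq] at hw ⊢
          rw [hsmul, hw, mul_zero] }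
    have hM : ∀ w, w ∈ M ↔ eval w f = 0 := fun w => Iff.rfl
    have hMcard : (Finset.univ.filter fun w : Fin 3 → F => eval w f = 0).card =
        Fintype.card F ^ Module.finrank F M := by
      rw [← Nat.card_eq_fintype_card (α := F), ← Module.natCard_eq_pow_finrank,
        ← Nat.card_eq_finsetCard]
      exact Nat.card_congr (Equiv.subtypeEquivRight (by simp [hM]))
    have hlt : Module.finrank F M < 3 := by
      have : M ≠ ⊤ := by
        intro h
        refine hf0 (hv.eq_zero_of_forall_eval two_ne_zero (Fintype.one_lt_card (α := F)) hf2
          fun i => ?_)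
        rw [← hM, h]; trivial
      simpa using Submodule.finrank_lt this
    -- Chevalley–Warning: the degree 2 is less than the 3 variables, so the characteristic divides
    -- the number of zeros, which therefore is not 1.
    have hpos : Module.finrank F M ≠ 0 := by
      intro h0
      rw [h0, pow_zero] at hMcard
      obtain ⟨p, hp⟩ := CharP.exists F
      have hdeg : f.totalDegree < Fintype.card (Fin 3) := by
        rw [hf2.totalDegree hf0, Fintype.card_fin]; norm_num
      have hdvd := char_dvd_card_solutions p hdeg
      rw [Fintype.card_subtype, hMcard, Nat.dvd_one] at hdvd
      exact CharP.char_ne_one F p hdvd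
    rw [hMcard] at hcard
    interval_cases hk : Module.finrank F M
    · exact absurd rfl hpos
    · left
      rw [pow_one, hr] at hcard
      exact hcancel _ (by omega)
    · right; left
      rw [hr] at hcard
      exact hcancel _ (by rw [hr]; nlinarith)

end Conics

/-! ### Moments of the number of points on a conic -/

lemma cast_choose_three (n : ℕ) : ((n.choose 3 : ℕ) : ℚ) = n * (n - 1) * (n - 2) / 6 := by
  induction n with
  | zero => simp
  | succ n ih =>
    rw [Nat.choose_succ_succ, Nat.cast_add, ih, Nat.cast_choose_two]
    push_cast
    ring

lemma cast_choose_four (n : ℕ) :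
    ((n.choose 4 : ℕ) : ℚ) = n * (n - 1) * (n - 2) * (n - 3) / 24 := by
  induction n with
  | zero => simp
  | succ n ih =>
    rw [Nat.choose_succ_succ, Nat.cast_add, ih, cast_choose_three]
    push_cast
    ring

section Moments

variable {F : Type*} [Field F] [Fintype F] {ι : Type*} [Fintype ι] {v : ι → Fin 3 → F}

omit [Fintype ι] in
lemma IsPointSystem.card_formsOn_two (hv : IsPointSystem v) {k : ℕ} (hk : k ≤ 3) {S : Finset ι}
    (hS : S.card = k) : (formsOn v 2 S).card = Fintype.card F ^ (6 - k) := by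
  have h := hv.card_formsOn S 2 (by omega)
  refine Nat.eq_of_mul_eq_mul_right (pow_pos (Fintype.card_pos (α := F)) k) ?_
  rw [← pow_add, Nat.sub_add_cancel (by omega), ← hS, h]
  rfl

lemma IsPointSystem.sum_nonzeroForms_two_choose [DecidableEq ι] (hv : IsPointSystem v)
    (A : Finset ι) {k : ℕ} (hk : k ≤ 3) :
    ∑ h ∈ nonzeroForms F 2, (((zeros v h ∩ A).card.choose k : ℕ) : ℚ) =
      (A.card.choose k : ℕ) * ((Fintype.card F : ℚ) ^ (6 - k) - 1) := by
  classical
  rw [sum_choose_card_inter, Finset.sum_congr rfl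
    (g := fun _ => (Fintype.card F : ℚ) ^ (6 - k) - 1), Finset.sum_const, nsmul_eq_mul,
    Finset.card_powersetCard]
  intro S hS
  convert card_nonzeroForms_filter v 2 S
  rw [hv.card_formsOn_two hk (Finset.mem_powersetCard.1 hS).2, Nat.cast_pow]

lemma IsPointSystem.sum_nonzeroPairs_two_choose [DecidableEq ι] (hv : IsPointSystem v)
    (A : Finset ι) {k : ℕ} (hk : k ≤ 3) :
    ∑ p ∈ nonzeroPairs F 2, (((commonZeros v p ∩ A).card.choose k : ℕ) : ℚ) =
      (A.card.choose k : ℕ) * (((Fintype.card F : ℚ) ^ (6 - k)) ^ 2 - 1) := by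
  classical
  rw [sum_choose_card_inter, Finset.sum_congr rfl
    (g := fun _ => ((Fintype.card F : ℚ) ^ (6 - k)) ^ 2 - 1), Finset.sum_const, nsmul_eq_mul,
    Finset.card_powersetCard]
  intro S hS
  convert card_nonzeroPairs_filter v 2 S
  rw [hv.card_formsOn_two hk (Finset.mem_powersetCard.1 hS).2, Nat.cast_pow]

/-- The distribution of the number of points on a conic. -/
lemma IsPointSystem.sum_nonzeroForms_two (hv : IsPointSystem v) (ψ : ℕ → ℚ) {q : ℚ}
    (hq : q = Fintype.card F) :
    ∑ h ∈ nonzeroForms F 2, ψ (zeros v h).card =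
      (q - 1) * ((q ^ 2 + q + 1) * (q ^ 2 - q) / 2 * ψ 1 +
        (q ^ 2 + q + 1) * (1 + q ^ 2 * (q - 1)) * ψ (Fintype.card F + 1) +
        (q ^ 2 + q + 1) * (q ^ 2 + q) / 2 * ψ (2 * Fintype.card F + 1)) := by
  classical
  have hq0 : q ≠ 0 := by
    rw [hq]; exact_mod_cast (Fintype.card_pos (α := F)).ne'
  have h0 := hv.sum_nonzeroForms_two_choose Finset.univ (k := 0) (by norm_num)
  have h1 := hv.sum_nonzeroForms_two_choose Finset.univ (k := 1) (by norm_num)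
  have h2 := hv.sum_nonzeroForms_two_choose Finset.univ (k := 2) (by norm_num)
  simp only [Finset.inter_univ, Finset.card_univ, hv.card_points, Nat.cast_choose_two,
    Nat.choose_one_right, Nat.choose_zero_right] at h0 h1 h2
  push_cast at h0 h1 h2
  rw [← hq] at h0 h1 h2
  -- Lagrange interpolation of ψ at 1, q + 1 and 2q + 1, written in terms of 1, n and n(n - 1)/2,
  -- whose sums over all conics are known.
  have hlag : ∀ h ∈ nonzeroForms F 2, ψ (zeros v h).card =
      (ψ 1 / 2 - ψ (Fintype.card F + 1) + ψ (2 * Fintype.card F + 1) / 2) / q ^ 2 * 2 *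
        (((zeros v h).card : ℚ) * ((zeros v h).card - 1) / 2) +
      (ψ 1 / 2 * (-1 - 3 * q) + ψ (Fintype.card F + 1) * (1 + 2 * q) +
        ψ (2 * Fintype.card F + 1) / 2 * (-1 - q)) / q ^ 2 * (zeros v h).card +
      (ψ 1 / 2 * (q + 1) * (2 * q + 1) - ψ (Fintype.card F + 1) * (2 * q + 1) +
        ψ (2 * Fintype.card F + 1) / 2 * (q + 1)) / q ^ 2 * 1 := by
    intro h hh
    rcases hv.card_zeros_conic hh with hz | hz | hz
    all_goals
      rw [hz]
      push_cast
      try rw [← hq]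
      field_simp
      ring
  rw [Finset.sum_congr rfl hlag, Finset.sum_add_distrib, Finset.sum_add_distrib, ← Finset.mul_sum,
    ← Finset.mul_sum, ← Finset.mul_sum, h0, h1, h2]
  field_simp
  ring

lemma zeros_eq_of_not_isRelPrime {f g : MvPolynomial (Fin 3) F}
    (hf : f ∈ nonzeroForms F 1) (hg : g ∈ nonzeroForms F 1) (h : ¬ IsRelPrime f g) :
    zeros v f = zeros v g := by
  simp only [IsRelPrime, not_forall] at h
  obtain ⟨d, hdf, hdg, hd⟩ := h
  have key : ∀ f ∈ nonzeroForms F 1, d ∣ f → zeros v f = zeros v d := by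
    intro f hf hdf
    obtain ⟨hf0, hf1⟩ := mem_nonzeroForms.1 hf
    obtain ⟨a, rfl⟩ := hdf
    obtain ⟨k, l, hkl, hk, hl⟩ := isHomogeneous_of_mul hf1 hf0
    have hd0 := left_ne_zero_of_mul hf0
    have ha0 := right_ne_zero_of_mul hf0
    have hk0 : k ≠ 0 := by
      rintro rfl
      exact hd (isUnit_of_isHomogeneous_zero hk hd0)
    obtain rfl : l = 0 := by omega
    classical
    rw [zeros_mul, zeros_of_mem_nonzeroForms_zero (mem_nonzeroForms.2 ⟨ha0, hl⟩),
      Finset.union_empty]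
  rw [key f hf hdf, key g hg hdg]

lemma IsPointSystem.card_compl_zeros [DecidableEq ι] (hv : IsPointSystem v)
    {l : MvPolynomial (Fin 3) F} (hl : l ∈ nonzeroForms F 1) :
    (zeros v l)ᶜ.card = Fintype.card F ^ 2 := by
  rw [Finset.card_compl, hv.card_points, hv.card_zeros_linear hl]
  omega

lemma IsPointSystem.card_zeros_inter_compl [DecidableEq ι] (hv : IsPointSystem v)
    {l m : MvPolynomial (Fin 3) F} (hl : l ∈ nonzeroForms F 1) (hm : m ∈ nonzeroForms F 1) :
    (zeros v m ∩ (zeros v l)ᶜ).card = 0 ∨ (zeros v m ∩ (zeros v l)ᶜ).card = Fintype.card F := by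
  by_cases h : IsRelPrime m l
  · right
    have h1 := hv.card_commonZeros_one (p := (m, l)) (mem_relPairs.2
      ⟨⟨(mem_nonzeroForms.1 hm).2, (mem_nonzeroForms.1 hl).2⟩, h⟩)
    have h2 := Finset.card_sdiff_add_card_inter (zeros v m) (zeros v l)
    have h3 : zeros v m ∩ zeros v l = commonZeros v (m, l) := by ext; simp
    rw [hv.card_zeros_linear hm, h3, h1] at h2
    rw [← Finset.sdiff_eq_inter_compl]
    omega
  · left
    rw [zeros_eq_of_not_isRelPrime hm hl h, Finset.inter_compl, Finset.card_empty]

/-- Only the values 0 (the line l itself) and q occur, so the number of forms and the first moment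
determine the sum. -/
lemma IsPointSystem.sum_nonzeroForms_one_inter_compl [DecidableEq ι] (hv : IsPointSystem v)
    {l : MvPolynomial (Fin 3) F} (hl : l ∈ nonzeroForms F 1) (ψ : ℕ → ℚ) {q : ℚ}
    (hq : q = Fintype.card F) :
    ∑ m ∈ nonzeroForms F 1, ψ (zeros v m ∩ (zeros v l)ᶜ).card =
      (q - 1) * ψ 0 + (q ^ 3 - q) * ψ (Fintype.card F) := by
  classical
  have hq0 : q ≠ 0 := by
    rw [hq]; exact_mod_cast (Fintype.card_pos (α := F)).ne'
  have h1 : ∑ m ∈ nonzeroForms F 1, ((zeros v m ∩ (zeros v l)ᶜ).card : ℚ) = q ^ 2 * (q ^ 2 - 1) := by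
    have := sum_choose_card_inter (nonzeroForms F 1) (zeros v) (zeros v l)ᶜ 1
    simp only [Nat.choose_one_right] at this
    rw [this, Finset.sum_congr rfl (g := fun _ => q ^ 2 - 1), Finset.sum_const, nsmul_eq_mul,
      Finset.card_powersetCard, Nat.choose_one_right, hv.card_compl_zeros hl, hq, Nat.cast_pow]
    intro S hS
    obtain ⟨i, rfl⟩ := Finset.card_eq_one.1 (Finset.mem_powersetCard.1 hS).2
    convert card_nonzeroForms_filter v 1 {i}
    rw [hv.card_formsOn_singleton, hq, Nat.cast_pow]
  have h0 := card_nonzeroForms (F := F) 1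
  rw [← hq, show (1 + 2 : ℕ).choose 2 = 3 from rfl] at h0
  have hlag : ∀ m ∈ nonzeroForms F 1, ψ (zeros v m ∩ (zeros v l)ᶜ).card =
      ψ 0 + (ψ (Fintype.card F) - ψ 0) / q * (zeros v m ∩ (zeros v l)ᶜ).card := by
    intro m hm
    rcases hv.card_zeros_inter_compl hl hm with hz | hz
    · rw [hz]; simp
    · rw [hz, ← hq]; field_simp; ring
  rw [Finset.sum_congr rfl hlag, Finset.sum_add_distrib, ← Finset.mul_sum, h1, Finset.sum_const,
    nsmul_eq_mul, h0]
  field_simp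
  ring

/-! ### Four points -/

omit [Fintype ι] in
lemma IsPointSystem.card_formsOn_one_pair (hv : IsPointSystem v) {i j : ι} (hij : i ≠ j)
    [DecidableEq ι] : (formsOn v 1 {i, j}).card = Fintype.card F := by
  have h := hv.card_formsOn {i, j} 1 (by rw [Finset.card_pair hij])
  rw [Finset.card_pair hij] at h
  refine Nat.eq_of_mul_eq_mul_right (pow_pos (Fintype.card_pos (α := F)) 2) ?_
  rw [h, show (1 + 2 : ℕ).choose 2 = 3 from rfl]
  ring

omit [Fintype ι] in
/-- There is only one line through two points. -/
lemma IsPointSystem.exists_eq_C_mul (hv : IsPointSystem v) {i j : ι} (hij : i ≠ j)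
    {f g : MvPolynomial (Fin 3) F} (hf : f ∈ nonzeroForms F 1) (hg : g.IsHomogeneous 1)
    (hfi : eval (v i) f = 0) (hfj : eval (v j) f = 0) (hgi : eval (v i) g = 0)
    (hgj : eval (v j) g = 0) : ∃ c, g = C c * f := by
  classical
  obtain ⟨hf0, hf1⟩ := mem_nonzeroForms.1 hf
  have himg : Finset.univ.image (fun c : F => C c * f) = formsOn v 1 {i, j} := by
    refine Finset.eq_of_subset_of_card_le ?_ ?_
    · intro h hh
      obtain ⟨c, -, rfl⟩ := Finset.mem_image.1 hh
      simpa [hfi, hfj] using hf1.C_mul c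
    · rw [hv.card_formsOn_one_pair hij, Finset.card_image_of_injective, Finset.card_univ]
      intro a b hab
      exact C_injective _ _ (mul_right_cancel₀ hf0 hab)
  have hgm : g ∈ formsOn v 1 {i, j} := by simpa [hgi, hgj] using hg
  rw [← himg] at hgm
  obtain ⟨c, -, hc⟩ := Finset.mem_image.1 hgm
  exact ⟨c, hc.symm⟩

omit [Fintype ι] in
lemma IsPointSystem.exists_line (hv : IsPointSystem v) {i j : ι} (hij : i ≠ j) :
    ∃ f ∈ nonzeroForms F 1, eval (v i) f = 0 ∧ eval (v j) f = 0 := by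
  classical
  have h1 : 1 < (formsOn v 1 {i, j}).card := by
    rw [hv.card_formsOn_one_pair hij]; exact Fintype.one_lt_card
  obtain ⟨f, hf, hf0⟩ := Finset.exists_mem_ne h1 0
  rw [mem_formsOn] at hf
  exact ⟨f, mem_nonzeroForms.2 ⟨hf0, hf.1⟩, hf.2 i (by simp), hf.2 j (by simp)⟩

/-- The conics through four points that are not collinear. -/
lemma IsPointSystem.card_formsOn_four (hv : IsPointSystem v) {S : Finset ι} (hS : S.card = 4)
    (hcol : ¬ ∃ m ∈ nonzeroForms F 1, S ⊆ zeros v m) :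
    (formsOn v 2 S).card = Fintype.card F ^ 2 := by
  classical
  have h := card_formsOn_mul v 2 S ?_
  · refine Nat.eq_of_mul_eq_mul_right (pow_pos (Fintype.card_pos (α := F)) 4) ?_
    rw [← pow_add, ← hS, h, hS]
    rfl
  intro i hi
  have h3 : (S.erase i).card = 3 := by rw [Finset.card_erase_of_mem hi, hS]
  obtain ⟨a, b, c, hab, hac, hbc, habc⟩ := Finset.card_eq_three.1 h3
  have hS' : S = {i, a, b, c} := by rw [← Finset.insert_erase hi, habc]
  have hia : a ≠ i := fun h => Finset.notMem_erase i S (by rw [habc, ← h]; simp)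
  have hib : b ≠ i := fun h => Finset.notMem_erase i S (by rw [habc, ← h]; simp)
  have hic : c ≠ i := fun h => Finset.notMem_erase i S (by rw [habc, ← h]; simp)
  -- A separating conic is the line through two of the other points times a line through the third
  -- that misses i. If i lay both on the line ab and on the line ac, all four points would be
  -- collinear.
  have key : ∀ x y z, x ≠ i → y ≠ i → z ≠ i → x ≠ y → S = {i, x, y, z} →
      (∀ m ∈ nonzeroForms F 1, eval (v x) m = 0 → eval (v y) m = 0 → eval (v i) m ≠ 0) →
      ∃ f : MvPolynomial (Fin 3) F, f.IsHomogeneous 2 ∧ eval (v i) f ≠ 0 ∧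
        ∀ j ∈ S, j ≠ i → eval (v j) f = 0 := by
    intro x y z hx hy hz hxy hSx hm
    obtain ⟨m, hm1, hmx, hmy⟩ := hv.exists_line hxy
    obtain ⟨n, hn, hni, hnz⟩ := hv.exists_separating hz.symm
    refine ⟨m * n, (mem_nonzeroForms.1 hm1).2.mul hn, ?_, ?_⟩
    · rw [map_mul]
      exact mul_ne_zero (hm m hm1 hmx hmy) hni
    · intro j hj hji
      rw [hSx] at hj
      simp only [Finset.mem_insert, Finset.mem_singleton] at hj
      rcases hj with rfl | rfl | rfl | rfl
      · exact absurd rfl hji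
      · simp [hmx]
      · simp [hmy]
      · simp [hnz]
  by_cases hm : ∀ m ∈ nonzeroForms F 1, eval (v a) m = 0 → eval (v b) m = 0 → eval (v i) m ≠ 0
  · exact key a b c hia hib hic hab hS' hm
  · push Not at hm
    obtain ⟨m, hm, hma, hmb, hmi⟩ := hm
    refine key a c b hia hic hib hac (by rw [hS', Finset.pair_comm b c]) ?_
    intro n hn hna hnc hni
    refine hcol ⟨n, hn, ?_⟩
    obtain ⟨e, he⟩ := hv.exists_eq_C_mul hia hm (mem_nonzeroForms.1 hn).2 hma hmi hna hni
    intro j hj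
    rw [hS'] at hj
    simp only [Finset.mem_insert, Finset.mem_singleton] at hj
    rw [mem_zeros]
    rcases hj with rfl | rfl | rfl | rfl
    · exact hni
    · exact hna
    · rw [he, map_mul, hmb, mul_zero]
    · exact hnc

/-- The conics through four collinear points. -/
lemma IsPointSystem.card_formsOn_four_of_collinear (hv : IsPointSystem v) {S : Finset ι}
    (hS : S.card = 4) {m : MvPolynomial (Fin 3) F} (hm : m ∈ nonzeroForms F 1)
    (hSm : S ⊆ zeros v m) : (formsOn v 2 S).card = Fintype.card F ^ 3 := by
  classical
  obtain ⟨hm0, hm1⟩ := mem_nonzeroForms.1 hm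
  obtain ⟨i, hi⟩ : S.Nonempty := Finset.card_pos.1 (by omega)
  have h3 : (S.erase i).card = 3 := by rw [Finset.card_erase_of_mem hi, hS]
  have hc := hv.card_formsOn_two le_rfl h3
  have hsub : (forms F 1).image (fun l => m * l) ⊆ formsOn v 2 S := by
    intro f hf
    obtain ⟨l, hl, rfl⟩ := Finset.mem_image.1 hf
    rw [mem_formsOn]
    refine ⟨hm1.mul (mem_forms.1 hl), fun j hj => ?_⟩
    rw [map_mul, mem_zeros.1 (hSm hj), zero_mul]
  -- Dropping one point leaves three independent conditions, hence at most q^3 conics; the multiples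
  -- of m already supply q^3.
  refine le_antisymm ?_ ?_
  · rw [← hc]
    refine Finset.card_le_card fun f hf => ?_
    rw [mem_formsOn] at hf ⊢
    exact ⟨hf.1, fun j hj => hf.2 j (Finset.mem_of_mem_erase hj)⟩
  · refine le_trans (le_of_eq ?_) (Finset.card_le_card hsub)
    rw [Finset.card_image_of_injective _ (mul_right_injective₀ hm0), card_forms]
    rfl

lemma IsPointSystem.sum_powersetCard_four [DecidableEq ι] (hv : IsPointSystem v)
    {l : MvPolynomial (Fin 3) F} (hl : l ∈ nonzeroForms F 1) (θ : ℕ → ℚ) {q : ℚ}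
    (hq : q = Fintype.card F) :
    ∑ S ∈ (zeros v l)ᶜ.powersetCard 4, θ (formsOn v 2 S).card =
      ((Fintype.card F ^ 2).choose 4 : ℕ) * θ (Fintype.card F ^ 2) +
        (q ^ 2 + q) * ((Fintype.card F).choose 4 : ℕ) *
          (θ (Fintype.card F ^ 3) - θ (Fintype.card F ^ 2)) := by
  have hq1 : q - 1 ≠ 0 := by rw [hq]; exact sub_ne_zero.2 one_lt_cardQ.ne'
  have h1 := hv.sum_nonzeroForms_one_inter_compl hl (fun n => (n.choose 4 : ℕ)) hq
  rw [sum_choose_card_inter] at h1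
  -- Collinearity is detected by the number of nonzero linear forms vanishing on S: q - 1 or 0.
  -- Summing over S then reduces to choosing four points on each line other than l.
  have h2 : ∀ S ∈ (zeros v l)ᶜ.powersetCard 4, θ (formsOn v 2 S).card = θ (Fintype.card F ^ 2) +
      (θ (Fintype.card F ^ 3) - θ (Fintype.card F ^ 2)) / (q - 1) *
        (((nonzeroForms F 1).filter fun m => S ⊆ zeros v m).card : ℚ) := by
    intro S hS
    have hS4 := (Finset.mem_powersetCard.1 hS).2
    by_cases hcol : ∃ m ∈ nonzeroForms F 1, S ⊆ zeros v m
    · obtain ⟨m, hm, hSm⟩ := hcol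
      rw [hv.card_formsOn_four_of_collinear hS4 hm hSm, card_nonzeroForms_filter]
      have h3 : (formsOn v 1 S).card = Fintype.card F := by
        obtain ⟨i, hi, j, hj, hij⟩ := Finset.one_lt_card.1 (show 1 < S.card by omega)
        rw [← hv.card_formsOn_one_pair hij]
        congr 1
        ext f
        simp only [mem_formsOn, Finset.mem_insert, Finset.mem_singleton, forall_eq_or_imp,
          forall_eq]
        constructor
        · exact fun h => ⟨h.1, h.2 i hi, h.2 j hj⟩
        · rintro ⟨hf, hfi, hfj⟩
          obtain ⟨c, rfl⟩ := hv.exists_eq_C_mul hij hm hf (mem_zeros.1 (hSm hi))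
            (mem_zeros.1 (hSm hj)) hfi hfj
          exact ⟨hf, fun k hk => by rw [map_mul, mem_zeros.1 (hSm hk), mul_zero]⟩
      rw [h3, ← hq]
      field_simp
      ring
    · rw [hv.card_formsOn_four hS4 hcol, Finset.filter_eq_empty_iff.2]
      · simp
      · exact fun m hm hSm => hcol ⟨m, hm, hSm⟩
  rw [Finset.sum_congr rfl h2, Finset.sum_add_distrib, ← Finset.mul_sum, h1, Finset.sum_const,
    Finset.card_powersetCard, hv.card_compl_zeros hl, nsmul_eq_mul]
  simp only [Nat.choose_zero_succ, Nat.cast_zero]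
  field_simp
  ring

end Moments

section Cubics

variable {F : Type*} [Field F] [Fintype F] {ι : Type*} [Fintype ι] {v : ι → Fin 3 → F}

/-! ### Coprime pairs of conics -/

/-- This is the common-line term. If the common line is l, the residual meeting point lies on l (q +
1 points) or off it (q² points). Any other line has q points off l, and the meeting point is new off
l unless it lies on one of the two lines, which have 2q + 1 points together. -/
lemma IsPointSystem.sum_line_pairs_inter_compl [DecidableEq ι] (hv : IsPointSystem v)
    {l : MvPolynomial (Fin 3) F} (hl : l ∈ nonzeroForms F 1) (ψ : ℕ → ℚ) {q : ℚ}
    (hq : q = Fintype.card F) :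
    ∑ h ∈ nonzeroForms F 1, ∑ p ∈ relPairs F 1,
        ψ ((zeros v h ∪ commonZeros v p) ∩ (zeros v l)ᶜ).card =
      (q ^ 2 - 1) * (q ^ 2 - q) * ((q - 1) * ((q + 1) * ψ 0 + q ^ 2 * ψ 1) +
        (q ^ 3 - q) * ((2 * q + 1) * ψ (Fintype.card F) +
          (q ^ 2 - q) * ψ (Fintype.card F + 1))) := by
  simp only [hv.sum_relPairs_one_union, hv.card_compl_zeros hl, hv.card_points]
  rw [hv.sum_nonzeroForms_one_inter_compl hl (fun n =>
    ((Fintype.card F : ℚ) ^ 2 - 1) * ((Fintype.card F : ℚ) ^ 2 - Fintype.card F) *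
      ((((Fintype.card F ^ 2 + Fintype.card F + 1 : ℕ) : ℚ) - (Fintype.card F ^ 2 : ℕ) + n) * ψ n +
        (((Fintype.card F ^ 2 : ℕ) : ℚ) - n) * ψ (n + 1))) hq]
  push_cast
  rw [← hq]
  ring

lemma IsPointSystem.sum_relPairs_two_choose [DecidableEq ι] (hv : IsPointSystem v)
    {l : MvPolynomial (Fin 3) F} (hl : l ∈ nonzeroForms F 1) {k : ℕ} (hk : k ≤ 3) {q : ℚ}
    (hq : q = Fintype.card F) :
    (q - 1) * ∑ p ∈ relPairs F 2, (((commonZeros v p ∩ (zeros v l)ᶜ).card.choose k : ℕ) : ℚ) =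
      (q - 1) * (((Fintype.card F ^ 2).choose k : ℕ) *
        (((q ^ (6 - k)) ^ 2 - 1) - (q + 1) * (q ^ (6 - k) - 1))) -
      (q ^ 2 - 1) * (q ^ 2 - q) * ((q - 1) * ((q + 1) * (Nat.choose 0 k : ℕ) +
          q ^ 2 * (Nat.choose 1 k : ℕ)) +
        (q ^ 3 - q) * ((2 * q + 1) * ((Fintype.card F).choose k : ℕ) +
          (q ^ 2 - q) * ((Fintype.card F + 1).choose k : ℕ))) := by
  have h := hv.sum_relPairs_two (fun W => (((W ∩ (zeros v l)ᶜ).card.choose k : ℕ) : ℚ))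
  rw [hv.sum_nonzeroForms_two_choose _ hk, hv.sum_nonzeroPairs_two_choose _ hk,
    hv.sum_line_pairs_inter_compl hl (fun n => (n.choose k : ℕ)) hq, hv.card_compl_zeros hl,
    ← hq] at h
  rw [h]
  ring

lemma IsPointSystem.sum_relPairs_two_choose_four [DecidableEq ι] (hv : IsPointSystem v)
    {l : MvPolynomial (Fin 3) F} (hl : l ∈ nonzeroForms F 1) {q : ℚ}
    (hq : q = Fintype.card F) :
    (q - 1) * ∑ p ∈ relPairs F 2, (((commonZeros v p ∩ (zeros v l)ᶜ).card.choose 4 : ℕ) : ℚ) =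
      (q - 1) * (((Fintype.card F ^ 2).choose 4 : ℕ) *
          (((q ^ 2) ^ 2 - 1) - (q + 1) * (q ^ 2 - 1)) +
        (q ^ 2 + q) * ((Fintype.card F).choose 4 : ℕ) *
          (((q ^ 3) ^ 2 - 1) - (q + 1) * (q ^ 3 - 1) -
            (((q ^ 2) ^ 2 - 1) - (q + 1) * (q ^ 2 - 1)))) -
      (q ^ 2 - 1) * (q ^ 2 - q) *
        (q ^ 3 - q) * ((2 * q + 1) * ((Fintype.card F).choose 4 : ℕ) +
          (q ^ 2 - q) * ((Fintype.card F + 1).choose 4 : ℕ)) := by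
  classical
  have h := hv.sum_relPairs_two (fun W => (((W ∩ (zeros v l)ᶜ).card.choose 4 : ℕ) : ℚ))
  have h1 := hv.sum_powersetCard_four hl (fun n => (n : ℚ) - 1) hq
  have h2 := hv.sum_powersetCard_four hl (fun n => (n : ℚ) ^ 2 - 1) hq
  simp only [← card_nonzeroForms_filter] at h1
  simp only [← card_nonzeroPairs_filter] at h2
  rw [sum_choose_card_inter, sum_choose_card_inter (nonzeroForms F 2)] at h
  rw [hv.sum_line_pairs_inter_compl hl (fun n => (n.choose 4 : ℕ)) hq, ← hq] at h
  rw [sum_choose_card_inter (nonzeroPairs F 2), h1, h2] at h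
  rw [sum_choose_card_inter, h, show Nat.choose 0 4 = 0 from rfl, show Nat.choose 1 4 = 0 from rfl]
  push_cast
  rw [← hq]
  ring

/-- The distribution of the number of common zeros outside a line of coprime pairs of conics. -/
lemma IsPointSystem.sum_relPairs_two_inter_compl [DecidableEq ι] (hv : IsPointSystem v)
    {l : MvPolynomial (Fin 3) F} (hl : l ∈ nonzeroForms F 1) (φ : ℕ → ℚ) {q : ℚ}
    (hq : q = Fintype.card F) :
    ∑ p ∈ relPairs F 2, φ (commonZeros v p ∩ (zeros v l)ᶜ).card =
      ((1 / 24 * (9 * q ^ 8 + 8 * q ^ 7 + 21 * q ^ 6 - 19 * q ^ 5 + 66 * q ^ 4 +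
          59 * q ^ 3 - 48 * q ^ 2 + 24) * (q + 1) * (q - 1) ^ 2 * q) -
        (1 + q ^ 2 * (q - 1)) * ((q ^ 2 - 1) * (q ^ 2 - q)) * (q + 1)) * φ 0 +
      ((1 / 6 * (2 * q ^ 5 + 2 * q ^ 4 - 7 * q ^ 3 + 42 * q ^ 2 - 33 * q + 6) *
          (q + 1) ^ 2 * (q - 1) ^ 2 * q ^ 3) -
        (1 + q ^ 2 * (q - 1)) * ((q ^ 2 - 1) * (q ^ 2 - q)) * q ^ 2) * φ 1 +
      (1 / 4 * (q ^ 3 - 2 * q ^ 2 + 14 * q - 11) * (q + 1) ^ 2 * (q - 1) ^ 3 * q ^ 4) * φ 2 +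
      (1 / 6 * (4 * q - 5) * (q + 1) ^ 2 * (q - 1) ^ 4 * q ^ 4) * φ 3 +
      (1 / 24 * (q - 1) ^ 4 * q ^ 4 * (q + 1) ^ 2 * (q ^ 2 - 3 * q + 3)) * φ 4 := by
  have hq1 : q - 1 ≠ 0 := by rw [hq]; exact sub_ne_zero.2 one_lt_cardQ.ne'
  have h0 := hv.sum_relPairs_two_choose hl (k := 0) (by norm_num) hq
  have h1 := hv.sum_relPairs_two_choose hl (k := 1) (by norm_num) hq
  have h2 := hv.sum_relPairs_two_choose hl (k := 2) (by norm_num) hq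
  have h3 := hv.sum_relPairs_two_choose hl (k := 3) (by norm_num) hq
  have h4 := hv.sum_relPairs_two_choose_four hl hq
  -- Newton's forward difference formula, exact up to order 4 because there are at most 4 common
  -- zeros.
  have hnewton : ∀ p ∈ relPairs F 2, φ (commonZeros v p ∩ (zeros v l)ᶜ).card =
      φ 0 * (((commonZeros v p ∩ (zeros v l)ᶜ).card.choose 0 : ℕ) : ℚ) +
      (φ 1 - φ 0) * (((commonZeros v p ∩ (zeros v l)ᶜ).card.choose 1 : ℕ) : ℚ) +
      (φ 2 - 2 * φ 1 + φ 0) * (((commonZeros v p ∩ (zeros v l)ᶜ).card.choose 2 : ℕ) : ℚ) +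
      (φ 3 - 3 * φ 2 + 3 * φ 1 - φ 0) *
        (((commonZeros v p ∩ (zeros v l)ᶜ).card.choose 3 : ℕ) : ℚ) +
      (φ 4 - 4 * φ 3 + 6 * φ 2 - 4 * φ 1 + φ 0) *
        (((commonZeros v p ∩ (zeros v l)ᶜ).card.choose 4 : ℕ) : ℚ) := by
    intro p hp
    have hle : (commonZeros v p ∩ (zeros v l)ᶜ).card ≤ 4 :=
      (Finset.card_le_card Finset.inter_subset_left).trans (card_commonZeros_le hv hp)
    generalize (commonZeros v p ∩ (zeros v l)ᶜ).card = n at hle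
    interval_cases n <;> norm_num [Nat.choose] <;> ring
  rw [Finset.sum_congr rfl hnewton]
  simp only [Finset.sum_add_distrib, ← Finset.mul_sum]
  apply mul_left_cancel₀ hq1
  simp only [mul_add]
  simp only [mul_left_comm (q - 1) _ (∑ _ ∈ _, _)]
  rw [h0, h1, h2, h3, h4]
  simp only [cast_choose_four, cast_choose_three, Nat.cast_choose_two, Nat.choose_one_right,
    Nat.choose_zero_right]
  push_cast
  rw [← hq]
  norm_num [Nat.choose]
  ring

/-! ### Pairs of cubics with a common component -/

/-- The pairs of nonzero polynomials that define distinct curves with a common component. -/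
def HasCommonComponent (p : MvPolynomial (Fin 3) F × MvPolynomial (Fin 3) F) : Prop :=
  p.1 ≠ 0 ∧ p.2 ≠ 0 ∧ ¬ SameCurve p.1 p.2 ∧ ShareComponent p.1 p.2

omit [Fintype F] in
lemma IsHomogeneous.not_isUnit {f : MvPolynomial (Fin 3) F} {d : ℕ} (hf : f.IsHomogeneous d)
    (hd : d ≠ 0) : ¬ IsUnit f := fun hu =>
  hd (hf.inj_right (isHomogeneous_zero_of_isUnit hu) hu.ne_zero)

/-- A common component means a nonconstant gcd, hence e ≠ 0. Two nonzero polynomials define distinct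
curves exactly when the coprime cofactors are not both constant, hence d ≠ 0. Coprime cofactors of
positive degree are automatically nonzero. -/
lemma hasCommonComponent_mul_iff {h : MvPolynomial (Fin 3) F} {d e : ℕ}
    {p : MvPolynomial (Fin 3) F × MvPolynomial (Fin 3) F} (hh : h ∈ nonzeroForms F e)
    (hp : p ∈ relPairs F d) :
    HasCommonComponent (h * p.1, h * p.2) ↔ e ≠ 0 ∧ d ≠ 0 := by
  obtain ⟨f, g⟩ := p
  obtain ⟨⟨hf, hg⟩, hrel⟩ := mem_relPairs.1 hp
  obtain ⟨hh0, hhe⟩ := mem_nonzeroForms.1 hh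
  simp only at hf hg hrel
  constructor
  · rintro ⟨h1, h2, h3, h4⟩
    simp only at h1 h2 h3 h4
    refine ⟨?_, ?_⟩
    · rintro rfl
      refine not_isRelPrime_of_shareComponent h1 h2 h4 ?_
      have hu := isUnit_of_isHomogeneous_zero hhe hh0
      rwa [isRelPrime_mul_unit_left_left hu, isRelPrime_mul_unit_left_right hu]
    · rintro rfl
      obtain ⟨a, ha, rfl⟩ := isUnit_iff_eq_C_of_isReduced.1
        (isUnit_of_isHomogeneous_zero hf (right_ne_zero_of_mul h1))
      obtain ⟨b, hb, rfl⟩ := isUnit_iff_eq_C_of_isReduced.1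
        (isUnit_of_isHomogeneous_zero hg (right_ne_zero_of_mul h2))
      refine h3 ⟨b / a, div_ne_zero hb.ne_zero ha.ne_zero, ?_⟩
      rw [smul_eq_C_mul, mul_left_comm, ← C_mul, div_mul_cancel₀ _ ha.ne_zero]
  · rintro ⟨he, hd⟩
    have hf0 : f ≠ 0 := by
      rintro rfl
      exact IsHomogeneous.not_isUnit hg hd (isRelPrime_zero_left.1 hrel)
    have hg0 : g ≠ 0 := by
      rintro rfl
      exact IsHomogeneous.not_isUnit hf hd (isRelPrime_zero_right.1 hrel)
    refine ⟨mul_ne_zero hh0 hf0, mul_ne_zero hh0 hg0, ?_, ?_⟩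
    · rintro ⟨a, -, ha⟩
      simp only at ha
      rw [smul_eq_C_mul, mul_left_comm] at ha
      have hfg := mul_left_cancel₀ hh0 ha
      exact IsHomogeneous.not_isUnit hf hd (hrel dvd_rfl ⟨C a, by rw [hfg, mul_comm]⟩)
    · refine shareComponent_of_not_isRelPrime (mul_ne_zero hh0 hf0) fun hcon => ?_
      exact IsHomogeneous.not_isUnit hhe he (hcon ⟨f, rfl⟩ ⟨g, rfl⟩)

open Classical in
/-- The pairs of cubic forms that define distinct curves with a common component. -/
noncomputable def comPairs (F : Type*) [Field F] [Fintype F] :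
    Finset (MvPolynomial (Fin 3) F × MvPolynomial (Fin 3) F) :=
  (forms F 3 ×ˢ forms F 3).filter HasCommonComponent

/-- Weighting the gcd decomposition by the indicator of a common component leaves only gcds of
degree 1 and 2. -/
lemma sum_comPairs [DecidableEq ι] (v : ι → Fin 3 → F) (φ : ℕ → ℚ) :
    ((Fintype.card F : ℚ) - 1) * ∑ p ∈ comPairs F, φ (commonZeros v p).card =
      ∑ h ∈ nonzeroForms F 1, ∑ p ∈ relPairs F 2, φ (zeros v h ∪ commonZeros v p).card +
      ∑ h ∈ nonzeroForms F 2, ∑ p ∈ relPairs F 1, φ (zeros v h ∪ commonZeros v p).card := by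
  classical
  have h := sum_nonzeroPairs (F := F) 3 (fun f g =>
    if HasCommonComponent (f, g) then φ (commonZeros v (f, g)).card else 0)
  have h1 : ∑ p ∈ nonzeroPairs F 3,
      (if HasCommonComponent (p.1, p.2) then φ (commonZeros v (p.1, p.2)).card else 0) =
      ∑ p ∈ comPairs F, φ (commonZeros v p).card := by
    rw [← Finset.sum_filter]
    refine Finset.sum_congr ?_ fun _ _ => rfl
    ext p
    simp only [Finset.mem_filter, mem_nonzeroPairs, comPairs, Finset.mem_product, mem_forms]
    constructor
    · exact fun h => ⟨h.1.2, h.2⟩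
    · exact fun h => ⟨⟨Or.inl h.2.1, h.1⟩, h.2⟩
  have h2 : ∀ e d, ∑ h ∈ nonzeroForms F e, ∑ p ∈ relPairs F d,
      (if HasCommonComponent (h * p.1, h * p.2) then
        φ (commonZeros v (h * p.1, h * p.2)).card else 0) =
      if e ≠ 0 ∧ d ≠ 0 then ∑ h ∈ nonzeroForms F e, ∑ p ∈ relPairs F d,
        φ (zeros v h ∪ commonZeros v p).card else 0 := by
    intro e d
    split_ifs with hed
    · refine Finset.sum_congr rfl fun h hh => Finset.sum_congr rfl fun p hp => ?_
      rw [if_pos ((hasCommonComponent_mul_iff hh hp).2 hed), commonZeros_mul]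
    · refine Finset.sum_eq_zero fun h hh => Finset.sum_eq_zero fun p hp => ?_
      rw [if_neg fun hc => hed ((hasCommonComponent_mul_iff hh hp).1 hc)]
  rw [h1] at h
  simp only [h2] at h
  rw [h]
  simp [Finset.sum_range_succ]

/-- The zero form contributes q + 1 times to the first term, but the pair (0, 0) occurs once; this
is the correction by q. -/
lemma IsPointSystem.sum_cubic_pairs (hv : IsPointSystem v) (φ : ℕ → ℚ) :
    ∑ p ∈ forms F 3 ×ˢ forms F 3, φ (commonZeros v p).card =
      ((Fintype.card F : ℚ) + 1) * ∑ h ∈ forms F 3, φ (zeros v h).card -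
        (Fintype.card F : ℚ) * φ (Fintype.card ι) +
        ∑ p ∈ comPairs F, φ (commonZeros v p).card +
        ∑ p ∈ relPairs F 3, φ (commonZeros v p).card := by
  classical
  have hz : (0 : MvPolynomial (Fin 3) F) ∈ forms F 3 := mem_forms.2 (isHomogeneous_zero _ _ _)
  have hz2 : (0 : MvPolynomial (Fin 3) F × MvPolynomial (Fin 3) F) ∈ forms F 3 ×ˢ forms F 3 :=
    Finset.mem_product.2 ⟨hz, hz⟩
  have hz0 : (zeros v (0 : MvPolynomial (Fin 3) F)).card = Fintype.card ι := by
    rw [← Finset.card_univ]; congr 1; ext; simp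
  have hz1 : (commonZeros v (0 : MvPolynomial (Fin 3) F × MvPolynomial (Fin 3) F)).card =
      Fintype.card ι := by
    rw [← Finset.card_univ]; congr 1; ext; simp
  rw [← Finset.add_sum_erase _ _ hz2, ← Finset.add_sum_erase _ _ hz, hz0, hz1]
  have h := sum_nonzeroPairs_commonZeros v 3 (fun W => φ W.card)
  have h3 := sum_zero_forms v 3 (fun W => φ W.card)
  have h4 := hv.sum_zero_pairs 3 (fun W => φ W.card)
  rw [Finset.sum_range_succ, Finset.sum_range_succ, Finset.sum_range_succ, Finset.sum_range_one,
    Nat.sub_zero, h3, Nat.sub_self, h4, add_assoc (_ * _),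
    show 3 - 1 = 2 from rfl, show 3 - 2 = 1 from rfl, ← sum_comPairs v φ] at h
  have h' : ((Fintype.card F : ℚ) - 1) *
      ∑ p ∈ (forms F 3 ×ˢ forms F 3).erase 0, φ (commonZeros v p).card = _ := h
  have h'' : ∑ h ∈ nonzeroForms F 3, φ (zeros v h).card =
    ∑ h ∈ (forms F 3).erase 0, φ (zeros v h).card := rfl
  apply mul_left_cancel₀ (sub_ne_zero.2 (one_lt_cardQ (F := F)).ne')
  rw [mul_add, h', h'']
  ring

lemma IsPointSystem.sum_line_mul_relPairs_two [DecidableEq ι] (hv : IsPointSystem v) (φ : ℕ → ℚ)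
    {l : MvPolynomial (Fin 3) F} (hl : l ∈ nonzeroForms F 1) :
    ∑ p ∈ relPairs F 2, φ (zeros v l ∪ commonZeros v p).card =
      ∑ p ∈ relPairs F 2,
        (fun n => φ (Fintype.card F + 1 + n)) (commonZeros v p ∩ (zeros v l)ᶜ).card := by
  refine Finset.sum_congr rfl fun p _ => ?_
  simp only
  rw [← hv.card_zeros_linear hl, ← Finset.sdiff_eq_inter_compl, add_comm,
    Finset.card_sdiff_add_card, Finset.union_comm]

lemma IsPointSystem.sum_conic_mul_relPairs_one [DecidableEq ι] (hv : IsPointSystem v) (φ : ℕ → ℚ)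
    {q : ℚ} (hq : q = Fintype.card F) :
    ∑ h ∈ nonzeroForms F 2, ∑ p ∈ relPairs F 1, φ (zeros v h ∪ commonZeros v p).card =
      (q ^ 2 - 1) * (q ^ 2 - q) * ((q - 1) * (q ^ 2 + q + 1) *
        ((q ^ 2 - q) / 2 * (φ 1 + (q ^ 2 + q) * φ 2) +
        (1 + q ^ 2 * (q - 1)) *
          ((q + 1) * φ (Fintype.card F + 1) + q ^ 2 * φ (Fintype.card F + 2)) +
        (q ^ 2 + q) / 2 * ((2 * q + 1) * φ (2 * Fintype.card F + 1) +
          (q ^ 2 - q) * φ (2 * Fintype.card F + 2)))) := by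
  have h1 : ∀ Z : Finset ι, ∑ p ∈ relPairs F 1, φ (Z ∪ commonZeros v p).card =
      (fun n : ℕ => (q ^ 2 - 1) * (q ^ 2 - q) * (n * φ n + (q ^ 2 + q + 1 - n) * φ (n + 1)))
        Z.card := by
    intro Z
    have := hv.sum_relPairs_one_union Z Finset.univ φ
    simp only [Finset.inter_univ, Finset.card_univ, hv.card_points] at this
    rw [this]
    push_cast
    rw [← hq]
    ring
  simp only [h1]
  rw [hv.sum_nonzeroForms_two (fun n : ℕ => (q ^ 2 - 1) * (q ^ 2 - q) *
    (n * φ n + (q ^ 2 + q + 1 - n) * φ (n + 1))) hq]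
  push_cast
  rw [← hq]
  norm_num [add_assoc]
  ring

/-- The distribution of the number of common zeros of the pairs with a common component. -/
lemma IsPointSystem.sum_comPairs (hv : IsPointSystem v) (φ : ℕ → ℚ) {q : ℚ}
    (hq : q = Fintype.card F) :
    ∑ p ∈ comPairs F, φ (commonZeros v p).card =
      1 / 2 * (q - 1) ^ 2 * (q ^ 2 + q + 1) * (q ^ 2 - q) * (q + 1) * q * φ 1 +
      1 / 2 * (q - 1) ^ 2 * (q ^ 2 + q + 1) * (q ^ 2 - q) * (q ^ 2 + q) * (q + 1) * q * φ 2 +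
      1 / 2 * (q ^ 2 + q + 1) * (2 * q + 1) * (q - 1) ^ 2 * q ^ 2 * (q + 1) ^ 2 *
        φ (2 * Fintype.card F + 1) +
      1 / 2 * (q ^ 2 + q + 1) * (q - 1) ^ 2 * (q ^ 2 + q) ^ 2 * (q ^ 2 - q) *
        φ (2 * Fintype.card F + 2) +
      1 / 24 * (9 * q ^ 8 + 8 * q ^ 7 + 21 * q ^ 6 - 19 * q ^ 5 + 66 * q ^ 4 +
        59 * q ^ 3 - 48 * q ^ 2 + 24) * (q ^ 2 + q + 1) * (q + 1) * (q - 1) ^ 2 * q *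
        φ (Fintype.card F + 1) +
      1 / 6 * (2 * q ^ 5 + 2 * q ^ 4 - 7 * q ^ 3 + 42 * q ^ 2 - 33 * q + 6) *
        (q ^ 2 + q + 1) * (q + 1) ^ 2 * (q - 1) ^ 2 * q ^ 3 * φ (Fintype.card F + 2) +
      1 / 4 * (q ^ 3 - 2 * q ^ 2 + 14 * q - 11) * (q ^ 2 + q + 1) *
        (q + 1) ^ 2 * (q - 1) ^ 3 * q ^ 4 * φ (Fintype.card F + 3) +
      1 / 6 * (q ^ 2 + q + 1) * (4 * q - 5) * (q + 1) ^ 2 * (q - 1) ^ 4 * q ^ 4 *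
        φ (Fintype.card F + 4) +
      1 / 24 * (q - 1) ^ 4 * q ^ 4 * (q + 1) ^ 2 * (q ^ 2 + q + 1) * (q ^ 2 - 3 * q + 3) *
        φ (Fintype.card F + 5) := by
  classical
  have hq1 : q - 1 ≠ 0 := by rw [hq]; exact sub_ne_zero.2 one_lt_cardQ.ne'
  have h := PlaneCubics.sum_comPairs v φ
  -- Conics with q + 1 points also contribute to φ(q + 1) and φ(q + 2). They supply exactly the
  -- terms subtracted in the coefficients of φ 0 and φ 1 in `sum_relPairs_two_inter_compl`.
  rw [hv.sum_conic_mul_relPairs_one φ hq, Finset.sum_congr rfl (fun l hl =>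
    (hv.sum_line_mul_relPairs_two φ hl).trans (hv.sum_relPairs_two_inter_compl hl (fun n => φ (Fintype.card F + 1 + n)) hq)),
    Finset.sum_const, nsmul_eq_mul, card_nonzeroForms, ← hq,
    show (1 + 2 : ℕ).choose 2 = 3 from rfl] at h
  apply mul_left_cancel₀ hq1
  rw [h]
  ring_nf

end Cubics

/-! ### The enumerators -/

section Enumerators

variable {F : Type*} [Field F] {N : ℕ} {v : Fin N → Fin 3 → F}

lemma ev_apply (v : Fin N → Fin 3 → F) (f : MvPolynomial (Fin 3) F) (i : Fin N) :
    ev v f i = eval (v i) f := by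
  simp [ev]

lemma pairWeight_ev_add (v : Fin N → Fin 3 → F)
    (p : MvPolynomial (Fin 3) F × MvPolynomial (Fin 3) F) :
    (commonZeros v p).card + pairWeight (ev v p.1) (ev v p.2) = N := by
  classical
  have h := Finset.card_add_card_compl (commonZeros v p)
  rw [Fintype.card_fin] at h
  rw [pairWeight]
  convert h using 3
  ext i
  simp [ev_apply, imp_iff_not_or]

lemma weight_ev_add (v : Fin N → Fin 3 → F) (f : MvPolynomial (Fin 3) F) :
    (zeros v f).card + weight (ev v f) = N := by
  classical
  have h := Finset.card_add_card_compl (zeros v f)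
  rw [Fintype.card_fin] at h
  rw [weight]
  convert h using 3
  ext i
  simp [ev_apply]

lemma mono_pairWeight_ev (v : Fin N → Fin 3 → F)
    (p : MvPolynomial (Fin 3) F × MvPolynomial (Fin 3) F) :
    mono (N - pairWeight (ev v p.1) (ev v p.2)) (pairWeight (ev v p.1) (ev v p.2)) =
      mono (commonZeros v p).card (N - (commonZeros v p).card) := by
  have h := pairWeight_ev_add v p
  congr 1 <;> omega

lemma mono_weight_ev (v : Fin N → Fin 3 → F) (f : MvPolynomial (Fin 3) F) :
    mono (N - weight (ev v f)) (weight (ev v f)) =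
      mono (zeros v f).card (N - (zeros v f).card) := by
  have h := weight_ev_add v f
  congr 1 <;> omega

variable [Fintype F]

lemma comEnumerator_eq (v : Fin N → Fin 3 → F) :
    comEnumerator v =
      ∑ p ∈ comPairs F, mono (commonZeros v p).card (N - (commonZeros v p).card) := by
  classical
  rw [comEnumerator]
  refine Finset.sum_bij (fun p _ => (p.1.1, p.2.1)) ?_ ?_ ?_ ?_
  · intro p hp
    obtain ⟨h1, h2, h3, h4⟩ := (Finset.mem_filter.1 hp).2
    simp only [comPairs, Finset.mem_filter, Finset.mem_product, mem_forms]
    exact ⟨⟨p.1.2, p.2.2⟩, fun h => h1 (Subtype.ext h), fun h => h2 (Subtype.ext h), h3, h4⟩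
  · intro p _ r _ h
    simp only [Prod.mk.injEq] at h
    exact Prod.ext (Subtype.ext h.1) (Subtype.ext h.2)
  · rintro ⟨f, g⟩ h
    simp only [comPairs, Finset.mem_filter, Finset.mem_product, mem_forms] at h
    obtain ⟨⟨hf, hg⟩, h1, h2, h3, h4⟩ := h
    refine ⟨(⟨f, hf⟩, ⟨g, hg⟩), Finset.mem_filter.2 ⟨Finset.mem_univ _, ?_, ?_, h3, h4⟩, rfl⟩
    · exact fun h => h1 (congrArg Subtype.val h)
    · exact fun h => h2 (congrArg Subtype.val h)
  · intro p _
    exact mono_pairWeight_ev v (p.1.1, p.2.1)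

/-- Injectivity lets sums over codewords be read as sums over forms. -/
lemma IsPointSystem.ev_injOn_forms (hv : IsPointSystem v) {d : ℕ} (hd : d ≠ 0)
    (hdF : d ≤ Fintype.card F) : Set.InjOn (ev v) (forms F d) := by
  intro f hf g hg h
  rw [SetLike.mem_coe, mem_forms] at hf hg
  refine sub_eq_zero.1 (hv.eq_zero_of_forall_eval hd hdF (hf.sub hg) fun i => ?_)
  rw [map_sub, ← ev_apply, ← ev_apply, h, sub_self]

lemma filter_mem_reedMuller [DecidableEq (Fin N → F)] (v : Fin N → Fin 3 → F) (d : ℕ)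
    [DecidablePred fun c => c ∈ (reedMuller v d : Set (Fin N → F))] :
    (Finset.univ.filter fun c => c ∈ (reedMuller v d : Set (Fin N → F))) =
      (forms F d).image (ev v) := by
  ext c
  rw [Finset.mem_filter, and_iff_right (Finset.mem_univ c)]
  simp only [SetLike.mem_coe, reedMuller, Submodule.mem_map, Finset.mem_image, mem_forms,
    mem_homogeneousSubmodule]

lemma IsPointSystem.weightEnumerator_eq (hv : IsPointSystem v) {d : ℕ} (hd : d ≠ 0)
    (hdF : d ≤ Fintype.card F) :
    weightEnumerator (reedMuller v d : Set (Fin N → F)) =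
      ∑ f ∈ forms F d, mono (zeros v f).card (N - (zeros v f).card) := by
  classical
  rw [weightEnumerator, filter_mem_reedMuller, Finset.sum_image (hv.ev_injOn_forms hd hdF)]
  exact Finset.sum_congr rfl fun f _ => mono_weight_ev v f

lemma IsPointSystem.secondWeightEnumerator_eq (hv : IsPointSystem v) {d : ℕ} (hd : d ≠ 0)
    (hdF : d ≤ Fintype.card F) :
    secondWeightEnumerator (reedMuller v d : Set (Fin N → F)) =
      ∑ p ∈ forms F d ×ˢ forms F d, mono (commonZeros v p).card (N - (commonZeros v p).card) := by
  classical
  rw [secondWeightEnumerator, filter_mem_reedMuller, Finset.sum_image (hv.ev_injOn_forms hd hdF),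
    Finset.sum_product]
  refine Finset.sum_congr rfl fun f _ => ?_
  rw [Finset.sum_image (hv.ev_injOn_forms hd hdF)]
  exact Finset.sum_congr rfl fun g _ => mono_pairWeight_ev v (f, g)

end Enumerators

lemma isPointSystem_of_equiv {F : Type*} [Field F] {ι : Type*} (p : ι ≃ ℙ F (Fin 3 → F))
    (v : ι → Fin 3 → F) (hv0 : ∀ i, v i ≠ 0)
    (hv : ∀ i, Projectivization.mk F (v i) (hv0 i) = p i) : IsPointSystem v where
  ne_zero := hv0
  eq_of_smul i j a h := by
    apply p.injective
    rw [← hv, ← hv, Projectivization.mk_eq_mk_iff']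
    exact ⟨a, h.symm⟩
  exists_smul w hw := by
    obtain ⟨i, hi⟩ := p.surjective (Projectivization.mk F w hw)
    rw [← hv, eq_comm, Projectivization.mk_eq_mk_iff'] at hi
    obtain ⟨a, ha⟩ := hi
    exact ⟨i, a, ha.symm⟩

end PlaneCubics

/-! ### The two enumerator identities -/

theorem mainTheorem6 {F : Type*} [Field F] [Fintype F] (q : ℕ) (hq : Fintype.card F = q)
    (hq2 : 2 < q)
    (p : Fin (q ^ 2 + q + 1) ≃ ℙ F (Fin 3 → F))
    (v : Fin (q ^ 2 + q + 1) → Fin 3 → F) (hv0 : ∀ i, v i ≠ 0)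
    (hv : ∀ i, Projectivization.mk F (v i) (hv0 i) = p i) :
    (PlaneCubics.comEnumerator v =
      MvPolynomial.C (1 / 2 * (q - 1) ^ 2 * (q ^ 2 + q + 1) * (q ^ 2 - q) * (q + 1) * q : ℚ) *
        PlaneCubics.mono 1 (q ^ 2 + q) +
      MvPolynomial.C (1 / 2 * (q - 1) ^ 2 * (q ^ 2 + q + 1) * (q ^ 2 - q) * (q ^ 2 + q) *
          (q + 1) * q : ℚ) *
        PlaneCubics.mono 2 (q ^ 2 + q - 1) +
      MvPolynomial.C (1 / 2 * (q ^ 2 + q + 1) * (2 * q + 1) * (q - 1) ^ 2 * q ^ 2 *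
          (q + 1) ^ 2 : ℚ) *
        PlaneCubics.mono (2 * q + 1) (q ^ 2 - q) +
      MvPolynomial.C (1 / 2 * (q ^ 2 + q + 1) * (q - 1) ^ 2 * (q ^ 2 + q) ^ 2 *
          (q ^ 2 - q) : ℚ) *
        PlaneCubics.mono (2 * q + 2) (q ^ 2 - q - 1) +
      MvPolynomial.C (1 / 24 * (9 * q ^ 8 + 8 * q ^ 7 + 21 * q ^ 6 - 19 * q ^ 5 + 66 * q ^ 4 +
          59 * q ^ 3 - 48 * q ^ 2 + 24) * (q ^ 2 + q + 1) * (q + 1) * (q - 1) ^ 2 * q : ℚ) *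
        PlaneCubics.mono (q + 1) (q ^ 2) +
      MvPolynomial.C (1 / 6 * (2 * q ^ 5 + 2 * q ^ 4 - 7 * q ^ 3 + 42 * q ^ 2 - 33 * q + 6) *
          (q ^ 2 + q + 1) * (q + 1) ^ 2 * (q - 1) ^ 2 * q ^ 3 : ℚ) *
        PlaneCubics.mono (q + 2) (q ^ 2 - 1) +
      MvPolynomial.C (1 / 4 * (q ^ 3 - 2 * q ^ 2 + 14 * q - 11) * (q ^ 2 + q + 1) *
          (q + 1) ^ 2 * (q - 1) ^ 3 * q ^ 4 : ℚ) *
        PlaneCubics.mono (q + 3) (q ^ 2 - 2) +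
      MvPolynomial.C (1 / 6 * (q ^ 2 + q + 1) * (4 * q - 5) * (q + 1) ^ 2 * (q - 1) ^ 4 *
          q ^ 4 : ℚ) *
        PlaneCubics.mono (q + 4) (q ^ 2 - 3) +
      MvPolynomial.C (1 / 24 * (q - 1) ^ 4 * q ^ 4 * (q + 1) ^ 2 * (q ^ 2 + q + 1) *
          (q ^ 2 - 3 * q + 3) : ℚ) *
        PlaneCubics.mono (q + 5) (q ^ 2 - 4)) ∧
    ∃ c : Fin 10 → ℕ,
      PlaneCubics.secondWeightEnumerator (PlaneCubics.reedMuller v 3 : Set (Fin (q ^ 2 + q + 1) → F)) =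
        MvPolynomial.C (q + 1 : ℚ) *
            PlaneCubics.weightEnumerator (PlaneCubics.reedMuller v 3 : Set (Fin (q ^ 2 + q + 1) → F)) -
          MvPolynomial.C (q : ℚ) * PlaneCubics.mono (q ^ 2 + q + 1) 0 +
          PlaneCubics.comEnumerator v +
          ∑ j : Fin 10, MvPolynomial.C (c j : ℚ) *
            PlaneCubics.mono (j : ℕ) (q ^ 2 + q + 1 - (j : ℕ)) := by
  have hps := PlaneCubics.isPointSystem_of_equiv p v hv0 hv
  have hqQ : (q : ℚ) = Fintype.card F := by rw [hq]
  -- c_j is the number of coprime pairs of cubics with exactly j common zeros; j ≤ 9 by Bézout.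
  refine ⟨?_, fun j => ((PlaneCubics.relPairs F 3).filter
    fun p => (PlaneCubics.commonZeros v p).card = j).card, ?_⟩
  · rw [PlaneCubics.comEnumerator_eq]
    -- Comparing the coefficients at m makes the weight rational-valued, as in `sum_comPairs`.
    ext m
    have h := hps.sum_comPairs
      (fun n => coeff m (PlaneCubics.mono n (q ^ 2 + q + 1 - n))) hqQ
    have e1 : q ^ 2 + q + 1 - 1 = q ^ 2 + q := by omega
    have e2 : q ^ 2 + q + 1 - 2 = q ^ 2 + q - 1 := by omega
    have e3 : q ^ 2 + q + 1 - (2 * q + 1) = q ^ 2 - q := by omega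
    have e4 : q ^ 2 + q + 1 - (2 * q + 2) = q ^ 2 - q - 1 := by omega
    have e5 : q ^ 2 + q + 1 - (q + 1) = q ^ 2 := by omega
    have e6 : q ^ 2 + q + 1 - (q + 2) = q ^ 2 - 1 := by omega
    have e7 : q ^ 2 + q + 1 - (q + 3) = q ^ 2 - 2 := by omega
    have e8 : q ^ 2 + q + 1 - (q + 4) = q ^ 2 - 3 := by omega
    have e9 : q ^ 2 + q + 1 - (q + 5) = q ^ 2 - 4 := by omega
    simp only [hq, e1, e2, e3, e4, e5, e6, e7, e8, e9] at h
    simp only [coeff_sum, coeff_add, coeff_C_mul]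
    exact h
  · rw [hps.secondWeightEnumerator_eq three_ne_zero (by omega),
      hps.weightEnumerator_eq three_ne_zero (by omega), PlaneCubics.comEnumerator_eq]
    ext m
    have h := hps.sum_cubic_pairs (fun n => coeff m (PlaneCubics.mono n (q ^ 2 + q + 1 - n)))
    have h9 : ∑ p ∈ PlaneCubics.relPairs F 3, coeff m (PlaneCubics.mono
        (PlaneCubics.commonZeros v p).card (q ^ 2 + q + 1 - (PlaneCubics.commonZeros v p).card)) =
        ∑ j : Fin 10, (((PlaneCubics.relPairs F 3).filter
          fun p => (PlaneCubics.commonZeros v p).card = j).card : ℚ) *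
            coeff m (PlaneCubics.mono (j : ℕ) (q ^ 2 + q + 1 - (j : ℕ))) := by
      rw [Fin.sum_univ_eq_sum_range (fun j => (((PlaneCubics.relPairs F 3).filter
        fun p => (PlaneCubics.commonZeros v p).card = j).card : ℚ) *
          coeff m (PlaneCubics.mono j (q ^ 2 + q + 1 - j))) 10,
        ← Finset.sum_fiberwise_of_maps_to (t := Finset.range 10)
          (g := fun p => (PlaneCubics.commonZeros v p).card)
          (fun p hp => Finset.mem_range.2
            (Nat.lt_succ_of_le (PlaneCubics.card_commonZeros_le hps hp)))]
      refine Finset.sum_congr rfl fun j _ => ?_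
      rw [← nsmul_eq_mul, ← Finset.sum_const]
      refine Finset.sum_congr rfl fun p hp => ?_
      rw [(Finset.mem_filter.1 hp).2]
    rw [h9, Fintype.card_fin, Nat.sub_self, hq] at h
    simp only [coeff_sum, coeff_add, coeff_sub, coeff_C_mul]
    exact h
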